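/- Consider the symmetric two-user Gaussian Z-interference channel with a shared key, $$Y_{1}=h_dX_{1}+h_cX_{2}+Z_{1},\qquad Y_{2}=h_dX_{2}+Z_{2},$$ used $n$ times. The gains $h_d,h_c$ are real, the noise samples are i.i.d. $\mathcal N(0,1)$ and independent of all inputs, and each transmitter $i\in\{1,2\}$ satisfies the average power constraint $\frac1n\sum_{t=1}^nE[X_{i,t}^2]\le P$, where $P\ge 0$. Transmitter $i$ has a message $W_i$, uniform on $\{1,\dots,2^{nR_i}\}$ with $R_i\ge 0$ and intended for receiver $i$. A key $K$, uniform on $\{1,\dots,2^{nR_K}\}$ with $R_K\ge0$, is known only to transmitter 2 and receiver 2, and $W_1,W_2,K$ are independent. Here $\{1,\dots,2^{x}\}$ denotes the set of positive integers not exceeding $2^{x}$. The encoders, $X_1^n$ from $W_1$ and $X_2^n$ from $(W_2,K)$, may be stochastic, with independent local randomness. Receiver 1 decodes $W_1$ from $Y_1^n$, and receiver 2 decodes $W_2$ from $(Y_2^n,K)$. The pair $(R_1,R_2)$ is secrecy-achievable if there is a sequence of such codes, one for each $n$, for which both average error probabilities tend to $0$ as $n\to\infty$ and $I(W_2;Y_1^n)\le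 n\epsilon_n$ with $\epsilon_n\to0$. **Theorem 3 (outer bound for the weak/moderate interference regime).** Let $\mathrm{SNR}=h_d^2P$ and $\mathrm{INR}=h_c^2P$, and suppose that $\mathrm{SNR}>\mathrm{INR}$. Then every secrecy-achievable pair $(R_1,R_2)$ satisfies $$R_1+R_2\le\log_2(1+\mathrm{SNR})-0.5\log_2(1+\mathrm{INR})+R_K .$$ -/

import Mathlib

open MeasureTheory ProbabilityTheory Filter Topology

/-- The mutual information `I(X; Y)`, in bits, of two random variables on `(Ω, μ)`: the relative
entropy of the joint law with respect to the product of the marginal laws. -/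
noncomputable def mutualInfoBits {Ω α β : Type*} [MeasurableSpace Ω] [MeasurableSpace α]
    [MeasurableSpace β] (μ : Measure Ω) (X : Ω → α) (Y : Ω → β) : ENNReal :=
  InformationTheory.klDiv (μ.map (fun ω => (X ω, Y ω))) ((μ.map X).prod (μ.map Y))
    / ENNReal.ofReal (Real.log 2)

/-- The parameters of a two-user Gaussian Z-interference channel
`Y₁ = h₁₁ X₁ + h₂₁ X₂ + Z₁`, `Y₂ = h₂₂ X₂ + Z₂` with average powers `P₁`, `P₂`. -/
structure GaussianZIC where
  h11 : ℝ
  h21 : ℝ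
  h22 : ℝ
  P1 : ℝ
  P2 : ℝ

/-- The symmetric channel: direct gains `hd`, cross gain `hc`, and a common power `P`. -/
def GaussianZIC.symmetric (hd hc P : ℝ) : GaussianZIC where
  h11 := hd
  h21 := hc
  h22 := hd
  P1 := P
  P2 := P

/-- The number of elements of `{1, 2, …, 2^{nR}}`, the positive integers that are at most
`2^{nR}`. -/
noncomputable def indexCount (n : ℕ) (R : ℝ) : ℕ := ⌊(2 : ℝ) ^ ((n : ℝ) * R)⌋₊

/-- A code of block length `n` with `M1` and `M2` messages and `L` keys. Both encoders may be
stochastic. The key is available at transmitter 2 and at receiver 2 only. -/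
structure ZICCode (n M1 M2 L : ℕ) where
  enc1 : Kernel (Fin M1) (Fin n → ℝ)
  enc1_markov : IsMarkovKernel enc1
  enc2 : Kernel (Fin M2 × Fin L) (Fin n → ℝ)
  enc2_markov : IsMarkovKernel enc2
  dec1 : (Fin n → ℝ) → Fin M1
  dec1_measurable : Measurable dec1
  dec2 : (Fin n → ℝ) × Fin L → Fin M2
  dec2_measurable : Measurable dec2

/-- The outcomes of one block transmission:
`((W₁, X₁ⁿ), ((W₂, K), X₂ⁿ)), (Z₁ⁿ, Z₂ⁿ)`. -/
abbrev ZICOutcome (n M1 M2 L : ℕ) : Type :=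
  ((Fin M1 × (Fin n → ℝ)) × ((Fin M2 × Fin L) × (Fin n → ℝ))) × ((Fin n → ℝ) × (Fin n → ℝ))

namespace ZICOutcome

variable {n M1 M2 L : ℕ}

def W1 (ω : ZICOutcome n M1 M2 L) : Fin M1 := ω.1.1.1

def X1 (ω : ZICOutcome n M1 M2 L) : Fin n → ℝ := ω.1.1.2

def W2 (ω : ZICOutcome n M1 M2 L) : Fin M2 := ω.1.2.1.1

/-- The shared key. -/
def key (ω : ZICOutcome n M1 M2 L) : Fin L := ω.1.2.1.2

def X2 (ω : ZICOutcome n M1 M2 L) : Fin n → ℝ := ω.1.2.2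

def Z1 (ω : ZICOutcome n M1 M2 L) : Fin n → ℝ := ω.2.1

def Z2 (ω : ZICOutcome n M1 M2 L) : Fin n → ℝ := ω.2.2

/-- The output at receiver 1. -/
def Y1 (ch : GaussianZIC) (ω : ZICOutcome n M1 M2 L) : Fin n → ℝ :=
  fun t => ch.h11 * ω.X1 t + ch.h21 * ω.X2 t + ω.Z1 t

/-- The output at receiver 2. -/
def Y2 (ch : GaussianZIC) (ω : ZICOutcome n M1 M2 L) : Fin n → ℝ :=
  fun t => ch.h22 * ω.X2 t + ω.Z2 t

end ZICOutcome

namespace ZICCode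

variable {n M1 M2 L : ℕ}

/-- The law of a block transmission. The messages and the key are independent and uniform, the
codewords are drawn by the two encoders with independent local randomness, and the noise samples
are independent standard Gaussian variables, independent of everything else. -/
noncomputable def law (C : ZICCode n M1 M2 L) : Measure (ZICOutcome n M1 M2 L) :=
  ((uniformOn (Set.univ : Set (Fin M1)) ⊗ₘ C.enc1).prod
    (uniformOn (Set.univ : Set (Fin M2 × Fin L)) ⊗ₘ C.enc2)).prod
  ((Measure.pi fun _ : Fin n => gaussianReal 0 1).prod
    (Measure.pi fun _ : Fin n => gaussianReal 0 1))

/-- The average power constraints `(1/n) ∑ₜ E[X_{i,t}²] ≤ Pᵢ`, `i = 1, 2`. -/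
def SatisfiesPower (C : ZICCode n M1 M2 L) (ch : GaussianZIC) : Prop :=
  ∑ t : Fin n, ∫⁻ ω, ENNReal.ofReal (ω.X1 t ^ 2) ∂C.law ≤ ENNReal.ofReal (n * ch.P1) ∧
  ∑ t : Fin n, ∫⁻ ω, ENNReal.ofReal (ω.X2 t ^ 2) ∂C.law ≤ ENNReal.ofReal (n * ch.P2)

/-- The average probability of error at receiver 1. -/
noncomputable def errorProb1 (C : ZICCode n M1 M2 L) (ch : GaussianZIC) : ENNReal :=
  C.law {ω | C.dec1 (ω.Y1 ch) ≠ ω.W1}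

/-- The average probability of error at receiver 2, which knows the key. -/
noncomputable def errorProb2 (C : ZICCode n M1 M2 L) (ch : GaussianZIC) : ENNReal :=
  C.law {ω | C.dec2 (ω.Y2 ch, ω.key) ≠ ω.W2}

/-- The information `I(W₂; Y₁ⁿ)`, in bits, that leaks to receiver 1. -/
noncomputable def leakage (C : ZICCode n M1 M2 L) (ch : GaussianZIC) : ENNReal :=
  mutualInfoBits C.law ZICOutcome.W2 (ZICOutcome.Y1 ch)

end ZICCode

/-- `(R1, R2)` is a secrecy-achievable rate pair for a shared key of rate `RK`: there are codes of
every block length which satisfy the power constraints, whose error probabilities vanish, and which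
satisfy the weak secrecy constraint `I(W₂; Y₁ⁿ) ≤ n εₙ`, `εₙ → 0`. -/
def GaussianZIC.IsSecrecyAchievable (ch : GaussianZIC) (RK R1 R2 : ℝ) : Prop :=
  0 ≤ R1 ∧ 0 ≤ R2 ∧
  ∃ C : ∀ n : ℕ, ZICCode n (indexCount n R1) (indexCount n R2) (indexCount n RK),
    (∀ n, (C n).SatisfiesPower ch) ∧
    Tendsto (fun n => (C n).errorProb1 ch) atTop (𝓝 0) ∧
    Tendsto (fun n => (C n).errorProb2 ch) atTop (𝓝 0) ∧
    ∃ ε : ℕ → ℝ, Tendsto ε atTop (𝓝 0) ∧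
      ∀ n, (C n).leakage ch ≤ ENNReal.ofReal (n * ε n)

/-! Write `A` and `B` for the signals `hd X₁` and `hd X₂`, `N` for standard noise and `a = hc/hd`,
so that receiver 1 sees `A + aB + N` and receiver 2 sees `B + N`; here `h` is differential entropy.
Three information estimates drive the converse. Fano at receiver 1 bounds `log M1` by `h(A + aB + N)
- h(aB + N)`, up to error terms. At receiver 2, forget the key and list the decodings under all `L`
keys: list Fano bounds `log M2 - log L` by `h(B + N) - h(B + N | W₂)`. Secrecy bounds `h(A + aB + N)
- h(A + aB + N | W₂)` by the leakage.

Since `|a| < 1`, `A + aB + N` is a degraded version of `B + N` as an observation of `B`, so data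
processing (`smoothEntropy_conv_map_le`), applied for each value of `W₂`, gives `h(A + aB + N | W₂)
≤ h(B + N | W₂) + h(A + N) - h(N)`. Adding everything, `h(A + aB + N)` and `h(B + N | W₂)` cancel
and there remains `[h(A + N) - h(N)] + [h(B + N) - h(aB + N)]`. The first bracket is at most its
Gaussian value (`smoothEntropy_le`), and so is the second (`smoothEntropy_sub_map_le`, by linear
estimation of `B + N` from a degraded copy). This is `sum_log_card_le`; dividing by `n` and letting
`n → ∞` gives the theorem.

Every entropy inequality is an instance of Gibbs' inequality: exhibit a positive `r` with `∫ r dP ≤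
1` and expand `∫ log r dP ≤ 0`. As each output contains Gaussian noise, all densities are positive
with logarithms of at most quadratic growth, so finite second moments make every term integrable. -/

/-! ### Squared norms and isotropic Gaussian densities. -/

/-- The squared Euclidean norm on `Fin n → ℝ`. -/
def sqNorm {n : ℕ} (x : Fin n → ℝ) : ℝ := ∑ t, x t ^ 2

/-- The law of `n` independent standard Gaussian variables. -/
noncomputable abbrev stdNoise (n : ℕ) : Measure (Fin n → ℝ) :=
  Measure.pi fun _ : Fin n => gaussianReal 0 1

/-- The density of `n` independent centred Gaussian variables of variance `v`. -/
noncomputable def isoPDF {n : ℕ} (v : NNReal) (x : Fin n → ℝ) : ℝ :=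
  ∏ t, gaussianPDFReal 0 v (x t)

variable {n : ℕ}

lemma sqNorm_nonneg (x : Fin n → ℝ) : 0 ≤ sqNorm x :=
  Finset.sum_nonneg fun _ _ => sq_nonneg _

@[fun_prop]
lemma measurable_sqNorm : Measurable (sqNorm (n := n)) := by
  unfold sqNorm; fun_prop

lemma sqNorm_add_le (x y : Fin n → ℝ) : sqNorm (x + y) ≤ 2 * sqNorm x + 2 * sqNorm y := by
  simp only [sqNorm, Finset.mul_sum, ← Finset.sum_add_distrib, Pi.add_apply]
  exact Finset.sum_le_sum fun t _ => by nlinarith [sq_nonneg (x t - y t)]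

lemma sqNorm_smul (c : ℝ) (x : Fin n → ℝ) : sqNorm (c • x) = c ^ 2 * sqNorm x := by
  simp [sqNorm, Finset.mul_sum, mul_pow]

lemma sqNorm_neg (x : Fin n → ℝ) : sqNorm (-x) = sqNorm x := by
  simp [sqNorm]

lemma sqNorm_sub_le (x y : Fin n → ℝ) : sqNorm (x - y) ≤ 2 * sqNorm x + 2 * sqNorm y := by
  rw [sub_eq_add_neg, ← sqNorm_neg y]; exact sqNorm_add_le _ _

lemma isoPDF_eq (v : NNReal) (x : Fin n → ℝ) :
    isoPDF v x = (√(2 * Real.pi * v))⁻¹ ^ n * Real.exp (-(sqNorm x / (2 * v))) := by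
  simp only [isoPDF, gaussianPDFReal, Finset.prod_mul_distrib, Finset.prod_const,
    Finset.card_univ, Fintype.card_fin, ← Real.exp_sum, sub_zero, sqNorm, Finset.sum_div]
  simp [neg_div]

@[fun_prop]
lemma measurable_isoPDF (v : NNReal) : Measurable (isoPDF (n := n) v) := by
  unfold isoPDF
  refine Finset.measurable_prod _ fun t _ => ?_
  exact (measurable_gaussianPDFReal 0 v).comp (measurable_pi_apply t)

lemma isoPDF_pos {v : NNReal} (hv : v ≠ 0) (x : Fin n → ℝ) : 0 < isoPDF v x :=
  Finset.prod_pos fun _ _ => gaussianPDFReal_pos _ _ _ hv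

lemma isoPDF_le (v : NNReal) (x : Fin n → ℝ) : isoPDF v x ≤ (√(2 * Real.pi * v))⁻¹ ^ n := by
  rw [isoPDF_eq]
  refine mul_le_of_le_one_right (by positivity) (Real.exp_le_one_iff.2 ?_)
  have := sqNorm_nonneg x
  have : 0 ≤ sqNorm x / (2 * v) := by positivity
  linarith

lemma log_isoPDF {v : NNReal} (hv : v ≠ 0) (x : Fin n → ℝ) :
    Real.log (isoPDF v x) = -(n / 2 * Real.log (2 * Real.pi * v)) - sqNorm x / (2 * v) := by
  have hv' : (0 : ℝ) < v := by positivity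
  have h : (0 : ℝ) < 2 * Real.pi * v := by positivity
  rw [isoPDF_eq, Real.log_mul (by positivity) (by positivity), Real.log_exp, Real.log_pow,
    Real.log_inv, Real.log_sqrt h.le]
  ring

lemma pi_gaussianReal_eq_withDensity {v : NNReal} (hv : v ≠ 0) :
    (Measure.pi fun _ : Fin n => gaussianReal 0 v) =
      volume.withDensity fun x => ENNReal.ofReal (isoPDF v x) := by
  refine Measure.pi_eq fun s hs => ?_
  have hms : MeasurableSet (Set.univ.pi s) := MeasurableSet.univ_pi hs
  rw [withDensity_apply _ hms, ← lintegral_indicator hms]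
  have h1 : ∀ x : Fin n → ℝ, (Set.univ.pi s).indicator
      (fun x => ENNReal.ofReal (isoPDF v x)) x =
      ENNReal.ofReal (∏ t, (s t).indicator (gaussianPDFReal 0 v) (x t)) := by
    intro x
    by_cases hx : x ∈ Set.univ.pi s
    · rw [Set.indicator_of_mem hx]
      congr 1
      exact Finset.prod_congr rfl fun t _ => (Set.indicator_of_mem (hx t trivial) _).symm
    · rw [Set.indicator_of_notMem hx]
      simp only [Set.mem_pi, not_forall] at hx
      obtain ⟨t, _, ht⟩ := hx
      rw [Finset.prod_eq_zero (Finset.mem_univ t) (Set.indicator_of_notMem ht _),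
        ENNReal.ofReal_zero]
  have hint : ∀ t, Integrable ((s t).indicator (gaussianPDFReal 0 v)) := fun t =>
    (integrable_gaussianPDFReal 0 v).indicator (hs t)
  have hnn : ∀ t x, 0 ≤ (s t).indicator (gaussianPDFReal 0 v) x := fun t x =>
    Set.indicator_nonneg (fun _ _ => gaussianPDFReal_nonneg _ _ _) _
  have hprod : Integrable fun x : Fin n → ℝ => ∏ t, (s t).indicator (gaussianPDFReal 0 v) (x t) :=
    Integrable.fintype_prod hint
  simp_rw [h1]
  rw [← ofReal_integral_eq_lintegral_ofReal hprod
    (ae_of_all _ fun x => Finset.prod_nonneg fun t _ => hnn t _),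
    integral_fintype_prod_volume_eq_prod, ENNReal.ofReal_prod_of_nonneg
    (fun t _ => integral_nonneg (hnn t))]
  refine Finset.prod_congr rfl fun t _ => ?_
  rw [integral_indicator (hs t), gaussianReal_apply_eq_integral _ hv]

lemma lintegral_isoPDF {v : NNReal} (hv : v ≠ 0) :
    ∫⁻ x : Fin n → ℝ, ENNReal.ofReal (isoPDF v x) = 1 := by
  have h := congrArg (fun μ => μ Set.univ) (pi_gaussianReal_eq_withDensity (n := n) hv)
  simp only [measure_univ, withDensity_apply _ MeasurableSet.univ, Measure.restrict_univ] at h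
  exact h.symm

lemma lintegral_stdNoise {F : (Fin n → ℝ) → ENNReal} (hF : Measurable F) :
    ∫⁻ z, F z ∂stdNoise n = ∫⁻ z, ENNReal.ofReal (isoPDF 1 z) * F z := by
  rw [stdNoise, pi_gaussianReal_eq_withDensity one_ne_zero,
    lintegral_withDensity_eq_lintegral_mul _ (by fun_prop) hF]
  rfl

/-- A rotation of two independent standard Gaussian vectors is standard Gaussian. -/
lemma stdNoise_map_conv_map {a c : ℝ} (h : a ^ 2 + c ^ 2 = 1) :
    (stdNoise n).map (a • ·) ∗ (stdNoise n).map (c • ·) = stdNoise n := by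
  have key : ∀ b : ℝ, (stdNoise n).map (b • ·) =
      Measure.pi fun _ : Fin n => (gaussianReal 0 1).map (b * ·) := by
    intro b
    exact Measure.pi_map_pi (f := fun _ x => b * x)
      (hμ := fun i => by infer_instance) (fun i => by fun_prop)
  rw [key, key, Measure.conv]
  simp_rw [gaussianReal_map_const_mul]
  rw [← (measurePreserving_arrowProdEquivProdArrow ℝ ℝ (Fin n) _ _).map_eq,
    Measure.map_map (by fun_prop) (by fun_prop)]
  have := Measure.pi_map_pi (ι := Fin n) (X := fun _ => ℝ × ℝ) (Y := fun _ => ℝ)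
    (μ := fun _ => (gaussianReal (a * 0) (.mk (a ^ 2) (sq_nonneg _) * 1)).prod
      (gaussianReal (c * 0) (.mk (c ^ 2) (sq_nonneg _) * 1))) (f := fun _ p => p.1 + p.2)
    (hμ := fun i => by infer_instance) (fun i => by fun_prop)
  refine Eq.trans this ?_
  congr 1
  funext i
  have h2 := gaussianReal_conv_gaussianReal (m₁ := a * 0) (m₂ := c * 0)
    (v₁ := .mk (a ^ 2) (sq_nonneg _) * 1) (v₂ := .mk (c ^ 2) (sq_nonneg _) * 1)
  rw [Measure.conv] at h2
  rw [h2]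
  congr 1
  · ring
  · ext; simpa using h

/-! ### Laws with finite second moment. -/

/-- Probability measures on `Fin n → ℝ` with a finite second moment. -/
class HasSecondMoment (ν : Measure (Fin n → ℝ)) : Prop extends IsProbabilityMeasure ν where
  integrable_sq : Integrable sqNorm ν

lemma integrable_sqNorm (ν : Measure (Fin n → ℝ)) [HasSecondMoment ν] : Integrable sqNorm ν :=
  HasSecondMoment.integrable_sq

lemma integrable_coord_sq_stdNoise (t : Fin n) :
    Integrable (fun x : Fin n → ℝ => x t ^ 2) (stdNoise n) :=
  (measurePreserving_eval (fun _ : Fin n => gaussianReal 0 1) t).integrable_comp_of_integrable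
    (g := fun x => x ^ 2) (memLp_id_gaussianReal 2).integrable_sq

lemma integral_coord_sq_stdNoise (t : Fin n) : ∫ x : Fin n → ℝ, x t ^ 2 ∂stdNoise n = 1 := by
  have h := (measurePreserving_eval (fun _ : Fin n => gaussianReal 0 1) t)
  have h1 : ∫ x, x ^ 2 ∂gaussianReal 0 1 = 1 := by
    have := variance_fun_id_gaussianReal (μ := 0) (v := 1)
    rw [variance_of_integral_eq_zero (by fun_prop) integral_id_gaussianReal] at this
    simpa using this
  rw [← h1, ← h.map_eq, integral_map h.aemeasurable (by fun_prop)]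

lemma integral_coord_stdNoise (t : Fin n) : ∫ x : Fin n → ℝ, x t ∂stdNoise n = 0 := by
  have h := (measurePreserving_eval (fun _ : Fin n => gaussianReal 0 1) t)
  have h0 := integral_id_gaussianReal (μ := 0) (v := 1)
  rw [← h.map_eq, integral_map h.aemeasurable measurable_id'.aestronglyMeasurable] at h0
  exact h0

instance : HasSecondMoment (stdNoise n) where
  integrable_sq := integrable_finsetSum _ fun t _ => integrable_coord_sq_stdNoise t

lemma integral_sqNorm_stdNoise : ∫ x, sqNorm x ∂stdNoise n = n := by
  simp only [sqNorm]
  rw [integral_finsetSum _ fun t _ => integrable_coord_sq_stdNoise t]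
  simp [integral_coord_sq_stdNoise]

instance HasSecondMoment.map_smul (ν : Measure (Fin n → ℝ)) [HasSecondMoment ν] (a : ℝ) :
    HasSecondMoment (ν.map (a • ·)) where
  toIsProbabilityMeasure := Measure.isProbabilityMeasure_map (by fun_prop)
  integrable_sq := by
    rw [integrable_map_measure measurable_sqNorm.aestronglyMeasurable (by fun_prop)]
    simpa [Function.comp_def, sqNorm_smul] using (integrable_sqNorm ν).const_mul (a ^ 2)

instance HasSecondMoment.conv (μ ν : Measure (Fin n → ℝ)) [HasSecondMoment μ]
    [HasSecondMoment ν] : HasSecondMoment (μ ∗ ν) where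
  integrable_sq := by
    rw [Measure.conv, integrable_map_measure measurable_sqNorm.aestronglyMeasurable (by fun_prop)]
    refine Integrable.mono' ((((integrable_sqNorm μ).comp_fst ν).const_mul 2).add
      (((integrable_sqNorm ν).comp_snd μ).const_mul 2))
      (measurable_sqNorm.comp (by fun_prop)).aestronglyMeasurable (ae_of_all _ fun p => ?_)
    rw [Function.comp_apply, Real.norm_of_nonneg (sqNorm_nonneg _)]
    exact sqNorm_add_le _ _

lemma HasSecondMoment.integrable_coord_sq (ν : Measure (Fin n → ℝ)) [HasSecondMoment ν]
    (t : Fin n) : Integrable (fun x => x t ^ 2) ν := by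
  refine (integrable_sqNorm ν).mono' (Measurable.aestronglyMeasurable (by fun_prop)) (ae_of_all _ fun x => ?_)
  rw [Real.norm_of_nonneg (sq_nonneg _)]
  exact Finset.single_le_sum (f := fun t => x t ^ 2) (fun _ _ => sq_nonneg _) (Finset.mem_univ t)

lemma HasSecondMoment.integrable_coord (ν : Measure (Fin n → ℝ)) [HasSecondMoment ν]
    (t : Fin n) : Integrable (fun x => x t) ν := by
  refine ((HasSecondMoment.integrable_coord_sq ν t).add (integrable_const (1 : ℝ))).mono'
    (measurable_pi_apply t).aestronglyMeasurable (ae_of_all _ fun x => ?_)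
  rw [Real.norm_eq_abs]
  simp only [Pi.add_apply]
  rw [abs_le]
  constructor <;> nlinarith [sq_nonneg (x t - 1), sq_nonneg (x t + 1)]

/-- The cross term vanishes because the noise is centred. The signal need not be centred: power
means second moment, not variance. -/
lemma integral_sqNorm_conv_stdNoise (μ : Measure (Fin n → ℝ)) [HasSecondMoment μ] (c : ℝ) :
    ∫ x, sqNorm x ∂(μ ∗ (stdNoise n).map (c • ·)) = ∫ x, sqNorm x ∂μ + c ^ 2 * n := by
  rw [Measure.conv, integral_map (by fun_prop) measurable_sqNorm.aestronglyMeasurable]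
  set ν := (stdNoise n).map (c • ·) with hν
  have hν2 : ∫ x, sqNorm x ∂ν = c ^ 2 * n := by
    rw [hν, integral_map (by fun_prop) measurable_sqNorm.aestronglyMeasurable]
    simp_rw [sqNorm_smul]
    rw [integral_const_mul, integral_sqNorm_stdNoise]
  have hνt : ∀ t, ∫ x : Fin n → ℝ, x t ∂ν = 0 := by
    intro t
    have hm : AEStronglyMeasurable (fun x : Fin n → ℝ => x t) ν :=
      (measurable_pi_apply t).aestronglyMeasurable
    rw [hν, integral_map (by fun_prop) hm]
    simp only [Pi.smul_apply, smul_eq_mul]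
    rw [integral_const_mul, integral_coord_stdNoise, mul_zero]
  have hexp : ∀ p : (Fin n → ℝ) × (Fin n → ℝ), sqNorm (p.1 + p.2) =
      sqNorm p.1 + sqNorm p.2 + ∑ t, 2 * (p.1 t * p.2 t) := by
    intro p
    simp only [sqNorm, Pi.add_apply, ← Finset.sum_add_distrib]
    exact Finset.sum_congr rfl fun t _ => by ring
  have hcross : ∀ t, Integrable (fun p : (Fin n → ℝ) × (Fin n → ℝ) => 2 * (p.1 t * p.2 t))
      (μ.prod ν) := fun t =>
    ((HasSecondMoment.integrable_coord μ t).mul_prod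
      (HasSecondMoment.integrable_coord ν t)).const_mul 2
  have i1 := (integrable_sqNorm μ).comp_fst ν
  have i2 := (integrable_sqNorm ν).comp_snd μ
  have hzero : ∀ t, ∫ p : (Fin n → ℝ) × (Fin n → ℝ), 2 * (p.1 t * p.2 t) ∂(μ.prod ν) = 0 := by
    intro t
    rw [integral_const_mul, integral_prod_mul (fun x : Fin n → ℝ => x t)
      (fun x : Fin n → ℝ => x t), hνt]
    simp
  calc ∫ p, sqNorm (p.1 + p.2) ∂(μ.prod ν)
      = ∫ p, ((sqNorm p.1 + sqNorm p.2) + ∑ t, 2 * (p.1 t * p.2 t)) ∂(μ.prod ν) := by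
        simp_rw [hexp]
    _ = ∫ p, (sqNorm p.1 + sqNorm p.2) ∂(μ.prod ν) +
          ∫ p, ∑ t, 2 * (p.1 t * p.2 t) ∂(μ.prod ν) :=
        integral_add (i1.add i2) (integrable_finsetSum _ fun t _ => hcross t)
    _ = ∫ p, sqNorm p.1 ∂(μ.prod ν) + ∫ p, sqNorm p.2 ∂(μ.prod ν) := by
        rw [integral_add i1 i2, integral_finsetSum _ fun t _ => hcross t]
        simp only [hzero, Finset.sum_const_zero, add_zero]
    _ = ∫ x, sqNorm x ∂μ + c ^ 2 * n := by
        rw [integral_fun_fst, integral_fun_snd, hν2]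
        simp

/-! ### Densities smoothed by Gaussian noise. -/

/-- The density of the convolution of `ν` with the standard Gaussian law. -/
noncomputable def smoothPDF (ν : Measure (Fin n → ℝ)) (y : Fin n → ℝ) : ℝ :=
  ∫ x, isoPDF 1 (y - x) ∂ν

@[fun_prop]
lemma measurable_smoothPDF (ν : Measure (Fin n → ℝ)) [SFinite ν] : Measurable (smoothPDF ν) := by
  have : StronglyMeasurable fun p : (Fin n → ℝ) × (Fin n → ℝ) => isoPDF 1 (p.1 - p.2) :=
    (by fun_prop : Measurable fun p : (Fin n → ℝ) × (Fin n → ℝ) =>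
      isoPDF 1 (p.1 - p.2)).stronglyMeasurable
  exact this.integral_prod_right.measurable

lemma integrable_isoPDF_sub (ν : Measure (Fin n → ℝ)) [IsProbabilityMeasure ν]
    (y : Fin n → ℝ) : Integrable (fun x => isoPDF 1 (y - x)) ν := by
  refine Integrable.mono' (integrable_const ((√(2 * Real.pi * (1 : NNReal)))⁻¹ ^ n))
    (Measurable.aestronglyMeasurable (by fun_prop)) (ae_of_all _ fun x => ?_)
  rw [Real.norm_of_nonneg (isoPDF_pos one_ne_zero _).le]
  exact isoPDF_le _ _

lemma smoothPDF_le (ν : Measure (Fin n → ℝ)) [IsProbabilityMeasure ν] (y : Fin n → ℝ) :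
    smoothPDF ν y ≤ (√(2 * Real.pi))⁻¹ ^ n := by
  have := integral_mono (integrable_isoPDF_sub ν y) (integrable_const _)
    (fun x => isoPDF_le 1 (y - x))
  simpa [smoothPDF] using this

/-- The bound `|y - x|² / 2 ≤ |y|² + |x|²` reduces the claim to averaging `exp(-|x|²)`. Using `1 + t
≤ exp t` at `t = m - |x|²`, where `m` is the second moment, plays the role of Jensen's inequality:
`1 + m - |x|²` has mean 1. -/
lemma le_smoothPDF (ν : Measure (Fin n → ℝ)) [HasSecondMoment ν] (y : Fin n → ℝ) :
    (√(2 * Real.pi))⁻¹ ^ n * Real.exp (-(sqNorm y + ∫ x, sqNorm x ∂ν)) ≤ smoothPDF ν y := by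
  set m := ∫ x, sqNorm x ∂ν with hm
  set K := (√(2 * Real.pi))⁻¹ ^ n with hK
  have hpt : ∀ x, K * Real.exp (-(sqNorm y + m)) * (1 + m - sqNorm x) ≤ isoPDF 1 (y - x) := by
    intro x
    have h1 : isoPDF 1 (y - x) = K * Real.exp (-(sqNorm (y - x) / 2)) := by
      simp [isoPDF_eq, hK]
    rw [h1, mul_assoc]
    refine mul_le_mul_of_nonneg_left ?_ (by positivity)
    have h2 := sqNorm_sub_le y x
    calc Real.exp (-(sqNorm y + m)) * (1 + m - sqNorm x)
        ≤ Real.exp (-(sqNorm y + m)) * Real.exp (m - sqNorm x) := by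
          refine mul_le_mul_of_nonneg_left ?_ (Real.exp_pos _).le
          have := Real.add_one_le_exp (m - sqNorm x)
          linarith
      _ ≤ _ := by
          rw [← Real.exp_add]
          refine Real.exp_le_exp.2 ?_
          linarith
  have hi : Integrable (fun x => K * Real.exp (-(sqNorm y + m)) * (1 + m - sqNorm x)) ν :=
    ((integrable_const _).sub (integrable_sqNorm ν)).const_mul _
  have := integral_mono hi (integrable_isoPDF_sub ν y) hpt
  rw [integral_const_mul, integral_sub (integrable_const _) (integrable_sqNorm ν), ← hm] at this
  simpa [smoothPDF] using this

lemma smoothPDF_pos (ν : Measure (Fin n → ℝ)) [HasSecondMoment ν] (y : Fin n → ℝ) :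
    0 < smoothPDF ν y :=
  lt_of_lt_of_le (by positivity) (le_smoothPDF ν y)

/-- Quadratic growth makes the log-density integrable under any law with a second moment, not only
its own. This is what permits splitting the integrals of log-ratios below. -/
lemma abs_log_smoothPDF_le (ν : Measure (Fin n → ℝ)) [HasSecondMoment ν] (y : Fin n → ℝ) :
    |Real.log (smoothPDF ν y)| ≤
      |Real.log ((√(2 * Real.pi))⁻¹ ^ n)| + sqNorm y + ∫ x, sqNorm x ∂ν := by
  have h1 := Real.log_le_log (smoothPDF_pos ν y) (smoothPDF_le ν y)
  have h2 := Real.log_le_log (by positivity) (le_smoothPDF ν y)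
  rw [Real.log_mul (by positivity) (by positivity), Real.log_exp] at h2
  have h3 := sqNorm_nonneg y
  have h4 : 0 ≤ ∫ x, sqNorm x ∂ν := integral_nonneg fun x => sqNorm_nonneg x
  have h5 := neg_abs_le (Real.log ((√(2 * Real.pi))⁻¹ ^ n))
  have h6 := le_abs_self (Real.log ((√(2 * Real.pi))⁻¹ ^ n))
  rw [abs_le]
  constructor <;> linarith

lemma integrable_log_smoothPDF (ν ρ : Measure (Fin n → ℝ)) [HasSecondMoment ν]
    [HasSecondMoment ρ] : Integrable (fun y => Real.log (smoothPDF ν y)) ρ := by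
  exact Integrable.mono' (((integrable_const _).add (integrable_sqNorm ρ)).add
    (integrable_const _)) (measurable_smoothPDF ν).log.aestronglyMeasurable
    (ae_of_all _ (abs_log_smoothPDF_le ν))

lemma integrable_log_isoPDF {v : NNReal} (hv : v ≠ 0) (ρ : Measure (Fin n → ℝ))
    [HasSecondMoment ρ] : Integrable (fun y => Real.log (isoPDF v y)) ρ := by
  simp_rw [log_isoPDF hv]
  exact (integrable_const _).sub ((integrable_sqNorm ρ).div_const _)

lemma integral_log_isoPDF_stdNoise : ∫ y : Fin n → ℝ, Real.log (isoPDF 1 y) ∂stdNoise n =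
    -(n / 2 * (Real.log (2 * Real.pi) + 1)) := by
  simp_rw [log_isoPDF one_ne_zero]
  rw [integral_sub (integrable_const _) ((integrable_sqNorm _).div_const _), integral_div,
    integral_sqNorm_stdNoise]
  simp
  ring

lemma lintegral_conv_stdNoise (ν : Measure (Fin n → ℝ)) [IsProbabilityMeasure ν]
    {F : (Fin n → ℝ) → ENNReal} (hF : Measurable F) :
    ∫⁻ y, F y ∂(ν ∗ stdNoise n) = ∫⁻ y, ENNReal.ofReal (smoothPDF ν y) * F y := by
  rw [Measure.lintegral_conv hF]
  have h1 : ∀ x, ∫⁻ z, F (x + z) ∂stdNoise n =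
      ∫⁻ y, ENNReal.ofReal (isoPDF 1 (y - x)) * F y := by
    intro x
    rw [lintegral_stdNoise (by fun_prop),
      ← lintegral_sub_right_eq_self (μ := volume)
        (fun z => ENNReal.ofReal (isoPDF 1 z) * F (x + z)) x]
    simp
  simp_rw [h1]
  rw [lintegral_lintegral_swap (by fun_prop)]
  refine lintegral_congr fun y => ?_
  rw [lintegral_mul_const _ (by fun_prop), smoothPDF,
    ofReal_integral_eq_lintegral_ofReal (integrable_isoPDF_sub ν y)
      (ae_of_all _ fun x => (isoPDF_pos one_ne_zero _).le)]

lemma lintegral_smoothPDF (ν : Measure (Fin n → ℝ)) [IsProbabilityMeasure ν] :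
    ∫⁻ y, ENNReal.ofReal (smoothPDF ν y) = 1 := by
  have := lintegral_conv_stdNoise ν (F := fun _ => 1) measurable_const
  simpa using this.symm

/-! ### Gibbs' inequality. -/

/-- Gibbs' inequality for a finite family of probability measures. -/
lemma sum_integral_log_nonpos {ι Ω : Type*} [Fintype ι] [MeasurableSpace Ω] (P : ι → Measure Ω)
    [∀ i, IsProbabilityMeasure (P i)] {r : ι → Ω → ℝ} (hm : ∀ i, Measurable (r i))
    (hpos : ∀ i, ∀ᵐ ω ∂P i, 0 < r i ω)
    (h : ∑ i, ∫⁻ ω, ENNReal.ofReal (r i ω) ∂P i ≤ Fintype.card ι)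
    (hi : ∀ i, Integrable (fun ω => Real.log (r i ω)) (P i)) :
    ∑ i, ∫ ω, Real.log (r i ω) ∂P i ≤ 0 := by
  have hfin : ∀ i, ∫⁻ ω, ENNReal.ofReal (r i ω) ∂P i ≠ ⊤ := fun i =>
    ((Finset.single_le_sum (f := fun i => ∫⁻ ω, ENNReal.ofReal (r i ω) ∂P i)
      (fun _ _ => zero_le) (Finset.mem_univ i)).trans
      h).trans_lt (ENNReal.natCast_lt_top _) |>.ne
  have hr : ∀ i, Integrable (r i) (P i) := fun i =>
    (lintegral_ofReal_ne_top_iff_integrable (hm i).aestronglyMeasurable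
      ((hpos i).mono fun ω hω => hω.le)).1 (hfin i)
  have hr' : ∀ i, ∫ ω, r i ω ∂P i = (∫⁻ ω, ENNReal.ofReal (r i ω) ∂P i).toReal := fun i =>
    integral_eq_lintegral_of_nonneg_ae ((hpos i).mono fun ω hω => hω.le)
      (hm i).aestronglyMeasurable
  -- `log r ≤ r - 1` is integrated for each index. Only the sum of the integrals of `r i` is
  -- controlled; a single one may exceed 1.
  have hle : ∀ i, ∫ ω, Real.log (r i ω) ∂P i ≤
      (∫⁻ ω, ENNReal.ofReal (r i ω) ∂P i).toReal - 1 := by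
    intro i
    have := integral_mono_ae (hi i) ((hr i).sub (integrable_const 1))
      ((hpos i).mono fun ω hω => Real.log_le_sub_one_of_pos hω)
    simp only [Pi.sub_apply] at this
    rw [integral_sub (hr i) (integrable_const 1), hr'] at this
    simpa using this
  have hsum := ENNReal.toReal_mono (ENNReal.natCast_ne_top _) h
  rw [ENNReal.toReal_sum fun i _ => hfin i, ENNReal.toReal_natCast] at hsum
  calc ∑ i, ∫ ω, Real.log (r i ω) ∂P i
      ≤ ∑ i, ((∫⁻ ω, ENNReal.ofReal (r i ω) ∂P i).toReal - 1) :=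
        Finset.sum_le_sum fun i _ => hle i
    _ ≤ 0 := by
        rw [Finset.sum_sub_distrib]
        simpa using hsum

/-- Gibbs' inequality. -/
lemma integral_log_nonpos {Ω : Type*} [MeasurableSpace Ω] (P : Measure Ω)
    [IsProbabilityMeasure P] {r : Ω → ℝ} (hm : Measurable r) (hpos : ∀ ω, 0 < r ω)
    (h : ∫⁻ ω, ENNReal.ofReal (r ω) ∂P ≤ 1)
    (hi : Integrable (fun ω => Real.log (r ω)) P) : ∫ ω, Real.log (r ω) ∂P ≤ 0 := by
  simpa using sum_integral_log_nonpos (ι := Unit) (fun _ => P) (r := fun _ => r) (fun _ => hm)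
    (fun _ => ae_of_all _ hpos) (by simpa using h) (fun _ => hi)

/-! ### Entropy inequalities under Gaussian smoothing. -/

lemma MeasureTheory.MeasurePreserving.integral_comp_of_measurable {α β : Type*}
    [MeasurableSpace α] [MeasurableSpace β] {μ : Measure α} {ν : Measure β} {g : α → β}
    (hg : MeasurePreserving g μ ν) {f : β → ℝ} (hf : Measurable f) :
    ∫ x, f (g x) ∂μ = ∫ y, f y ∂ν := by
  rw [← hg.map_eq, integral_map hg.aemeasurable hf.aestronglyMeasurable]

lemma measurePreserving_add_conv (μ ν : Measure (Fin n → ℝ)) :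
    MeasurePreserving (fun p : (Fin n → ℝ) × (Fin n → ℝ) => p.1 + p.2) (μ.prod ν) (μ ∗ ν) :=
  ⟨by fun_prop, rfl⟩

lemma measurePreserving_smul_add (a : ℝ) (μ θ : Measure (Fin n → ℝ)) [SFinite μ] [SFinite θ] :
    MeasurePreserving (fun p : (Fin n → ℝ) × (Fin n → ℝ) => a • p.1 + p.2) (μ.prod θ)
      (μ.map (a • ·) ∗ θ) := by
  have h1 : MeasurePreserving (fun x : Fin n → ℝ => a • x) μ (μ.map (a • ·)) :=
    ⟨by fun_prop, rfl⟩
  exact (measurePreserving_add_conv _ _).comp (h1.prod (MeasurePreserving.id θ))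

lemma map_smul_conv (a : ℝ) (μ ν : Measure (Fin n → ℝ)) [SFinite μ] [SFinite ν] :
    (μ ∗ ν).map (a • ·) = μ.map (a • ·) ∗ ν.map (a • ·) :=
  Measure.map_conv_continuousLinearMap (a • ContinuousLinearMap.id ℝ (Fin n → ℝ))

/-- The differential entropy, in nats, of the convolution of `ν` with the standard Gaussian
law. -/
noncomputable def smoothEntropy (ν : Measure (Fin n → ℝ)) : ℝ :=
  -∫ y, Real.log (smoothPDF ν y) ∂(ν ∗ stdNoise n)

/-- Adding an independent variable does not decrease the entropy. -/
lemma smoothEntropy_le_conv (ν μ : Measure (Fin n → ℝ)) [HasSecondMoment ν]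
    [HasSecondMoment μ] : smoothEntropy μ ≤ smoothEntropy (ν ∗ μ) := by
  have mp : MeasurePreserving (fun p : (Fin n → ℝ) × (Fin n → ℝ) => p.1 + p.2)
      (ν.prod (μ ∗ stdNoise n)) ((ν ∗ μ) ∗ stdNoise n) := by
    rw [Measure.conv_assoc]; exact measurePreserving_add_conv _ _
  have mp2 : MeasurePreserving (Prod.snd : (Fin n → ℝ) × (Fin n → ℝ) → _)
      (ν.prod (μ ∗ stdNoise n)) (μ ∗ stdNoise n) := measurePreserving_snd
  have i1 := mp.integrable_comp_of_integrable
    (integrable_log_smoothPDF (ν ∗ μ) ((ν ∗ μ) ∗ stdNoise n))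
  have i2 := mp2.integrable_comp_of_integrable (integrable_log_smoothPDF μ (μ ∗ stdNoise n))
  simp only [Function.comp_def] at i1 i2
  have hlog : ∀ p : (Fin n → ℝ) × (Fin n → ℝ),
      Real.log (smoothPDF (ν ∗ μ) (p.1 + p.2) / smoothPDF μ p.2) =
        Real.log (smoothPDF (ν ∗ μ) (p.1 + p.2)) - Real.log (smoothPDF μ p.2) := fun p =>
    Real.log_div (smoothPDF_pos _ _).ne' (smoothPDF_pos _ _).ne'
  -- With `x` fixed, the denominator is the density of `u`, so the integral of the ratio is that of
  -- a translated density, hence 1.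
  have key := integral_log_nonpos (ν.prod (μ ∗ stdNoise n))
    (r := fun p => smoothPDF (ν ∗ μ) (p.1 + p.2) / smoothPDF μ p.2) (by fun_prop)
    (fun p => div_pos (smoothPDF_pos _ _) (smoothPDF_pos _ _)) ?_ ?_
  · simp_rw [hlog] at key
    rw [integral_sub i1 i2, mp.integral_comp_of_measurable (f := fun y =>
      Real.log (smoothPDF (ν ∗ μ) y)) (by fun_prop), mp2.integral_comp_of_measurable (f := fun y =>
      Real.log (smoothPDF μ y)) (by fun_prop)] at key
    simp only [smoothEntropy]
    linarith
  · rw [lintegral_prod _ (by fun_prop)]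
    have h1 : ∀ x, ∫⁻ u, ENNReal.ofReal (smoothPDF (ν ∗ μ) (x + u) / smoothPDF μ u)
        ∂(μ ∗ stdNoise n) = 1 := by
      intro x
      rw [lintegral_conv_stdNoise _ (by fun_prop), ← lintegral_smoothPDF (ν ∗ μ),
        ← lintegral_add_left_eq_self (μ := volume)
          (fun y => ENNReal.ofReal (smoothPDF (ν ∗ μ) y)) x]
      refine lintegral_congr fun u => ?_
      rw [← ENNReal.ofReal_mul (smoothPDF_pos _ _).le, mul_div_cancel₀ _ (smoothPDF_pos _ _).ne']
    simp [h1]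
  · simp_rw [hlog]
    exact i1.sub i2

/-- The Gaussian law maximises the entropy under a second moment constraint. -/
lemma smoothEntropy_le (α : Measure (Fin n → ℝ)) [HasSecondMoment α] {Q : ℝ}
    (hQ : 0 ≤ Q) (h : ∫ x, sqNorm x ∂α ≤ n * Q) :
    smoothEntropy α ≤ n / 2 * Real.log (2 * Real.pi * (1 + Q)) + n / 2 := by
  set v : NNReal := ⟨1 + Q, by linarith⟩ with hv
  have hvc : (v : ℝ) = 1 + Q := rfl
  have hv0 : v ≠ 0 := by
    intro h0
    have : (v : ℝ) = 0 := by rw [h0]; rfl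
    linarith
  have hms : ∫ x, sqNorm x ∂(α ∗ stdNoise n) ≤ n * (1 + Q) := by
    have h1 := integral_sqNorm_conv_stdNoise α 1
    simp only [one_smul, Measure.map_id', one_pow, one_mul] at h1
    rw [h1]; linarith
  have i1 := integrable_log_isoPDF hv0 (α ∗ stdNoise n)
  have i2 := integrable_log_smoothPDF α (α ∗ stdNoise n)
  have hlog : ∀ y : Fin n → ℝ, Real.log (isoPDF v y / smoothPDF α y) =
      Real.log (isoPDF v y) - Real.log (smoothPDF α y) := fun y =>
    Real.log_div (isoPDF_pos hv0 _).ne' (smoothPDF_pos _ _).ne'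
  -- Gibbs against the Gaussian of variance `1 + Q`: its log-density depends on `y` only through
  -- `|y|²`, so the moment bound suffices.
  have key := integral_log_nonpos (α ∗ stdNoise n)
    (r := fun y => isoPDF v y / smoothPDF α y) (by fun_prop)
    (fun p => div_pos (isoPDF_pos hv0 _) (smoothPDF_pos _ _)) ?_ ?_
  · simp_rw [hlog] at key
    rw [integral_sub i1 i2] at key
    simp_rw [log_isoPDF hv0] at key
    rw [integral_sub (integrable_const _) ((integrable_sqNorm _).div_const _),
      integral_div] at key
    simp only [integral_const, probReal_univ, smul_eq_mul, one_mul, hvc] at key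
    have h2 : (∫ x, sqNorm x ∂(α ∗ stdNoise n)) / (2 * (1 + Q)) ≤ n / 2 := by
      rw [div_le_div_iff₀ (by positivity) (by positivity)]
      linarith
    simp only [smoothEntropy]
    linarith
  · rw [lintegral_conv_stdNoise _ (by fun_prop), ← lintegral_isoPDF (n := n) hv0]
    refine (lintegral_congr fun u => ?_).le
    rw [← ENNReal.ofReal_mul (smoothPDF_pos _ _).le, mul_div_cancel₀ _ (smoothPDF_pos _ _).ne']
  · simp_rw [hlog]
    exact i1.sub i2

/-- Data processing: if `X ~ ν`, `U ~ α` and `|a| ≤ 1`, with `X`, `U` and the standard Gaussian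
vector `N` independent, then `I(X; aX + U + N) ≤ I(X; X + N)`. -/
lemma smoothEntropy_conv_map_le (α ν : Measure (Fin n → ℝ)) [HasSecondMoment α]
    [HasSecondMoment ν] {a : ℝ} (ha : a ^ 2 ≤ 1) :
    smoothEntropy (α ∗ ν.map (a • ·)) + n / 2 * (Real.log (2 * Real.pi) + 1) ≤
      smoothEntropy ν + smoothEntropy α := by
  set c := √(1 - a ^ 2) with hc
  have hac : a ^ 2 + c ^ 2 = 1 := by rw [hc, Real.sq_sqrt (by linarith)]; ring
  set γ := stdNoise n with hγ
  -- The noise is split as `aZ + cZ'`, so that `aX + U + N` becomes `a(X + Z) + (cZ' + U)`: a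
  -- function of `X + Z` and of an independent variable with law `θ`.
  set θ := γ.map (c • ·) ∗ α with hθ
  set κ := α ∗ ν.map (a • ·) with hκ
  have : HasSecondMoment γ := by rw [hγ]; infer_instance
  have : HasSecondMoment θ := by rw [hθ]; infer_instance
  have : HasSecondMoment κ := by rw [hκ]; infer_instance
  have hγθ : γ.map (a • ·) ∗ θ = α ∗ γ := by
    rw [hθ, ← Measure.conv_assoc, hγ, stdNoise_map_conv_map hac, Measure.conv_comm]
  have hνθ : (ν ∗ γ).map (a • ·) ∗ θ = κ ∗ γ := by
    rw [map_smul_conv, Measure.conv_assoc, hγθ, ← Measure.conv_assoc,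
      Measure.conv_comm (ν.map _) α]
  have : SFinite (ν.prod γ) := Measure.prod.instSFinite
  set P := (ν.prod γ).prod θ with hP
  have mpY : MeasurePreserving (fun ω : ((Fin n → ℝ) × (Fin n → ℝ)) × (Fin n → ℝ) =>
      ω.1.1 + ω.1.2) P (ν ∗ γ) :=
    (measurePreserving_add_conv ν γ).comp measurePreserving_fst
  have mpZ : MeasurePreserving (fun ω : ((Fin n → ℝ) × (Fin n → ℝ)) × (Fin n → ℝ) =>
      ω.1.2) P γ := measurePreserving_snd.comp measurePreserving_fst
  have mpU : MeasurePreserving (fun ω : ((Fin n → ℝ) × (Fin n → ℝ)) × (Fin n → ℝ) =>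
      a • ω.1.2 + ω.2) P (α ∗ γ) := by
    rw [← hγθ]
    exact (measurePreserving_smul_add a γ θ).comp
      ((measurePreserving_snd (μ := ν) (ν := γ)).prod (MeasurePreserving.id θ))
  have mpV : MeasurePreserving (fun ω : ((Fin n → ℝ) × (Fin n → ℝ)) × (Fin n → ℝ) =>
      a • (ω.1.1 + ω.1.2) + ω.2) P (κ ∗ γ) := by
    rw [← hνθ]
    exact (measurePreserving_smul_add a (ν ∗ γ) θ).comp
      ((measurePreserving_add_conv ν γ).prod (MeasurePreserving.id θ))
  have iY := mpY.integrable_comp_of_integrable (integrable_log_smoothPDF ν (ν ∗ γ))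
  have iZ := mpZ.integrable_comp_of_integrable (integrable_log_isoPDF one_ne_zero γ)
  have iU := mpU.integrable_comp_of_integrable (integrable_log_smoothPDF α (α ∗ γ))
  have iV := mpV.integrable_comp_of_integrable (integrable_log_smoothPDF κ (κ ∗ γ))
  simp only [Function.comp_def] at iY iZ iU iV
  have iYU : Integrable (fun ω : ((Fin n → ℝ) × (Fin n → ℝ)) × (Fin n → ℝ) =>
      Real.log (smoothPDF ν (ω.1.1 + ω.1.2)) + Real.log (smoothPDF α (a • ω.1.2 + ω.2))) P :=
    iY.add iU
  have iZV : Integrable (fun ω : ((Fin n → ℝ) × (Fin n → ℝ)) × (Fin n → ℝ) =>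
      Real.log (isoPDF 1 ω.1.2) + Real.log (smoothPDF κ (a • (ω.1.1 + ω.1.2) + ω.2))) P :=
    iZ.add iV
  have hlog : ∀ ω : ((Fin n → ℝ) × (Fin n → ℝ)) × (Fin n → ℝ),
      Real.log (smoothPDF ν (ω.1.1 + ω.1.2) * smoothPDF α (a • ω.1.2 + ω.2) /
        (isoPDF 1 ω.1.2 * smoothPDF κ (a • (ω.1.1 + ω.1.2) + ω.2))) =
      (Real.log (smoothPDF ν (ω.1.1 + ω.1.2)) + Real.log (smoothPDF α (a • ω.1.2 + ω.2))) -
        (Real.log (isoPDF 1 ω.1.2) +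
          Real.log (smoothPDF κ (a • (ω.1.1 + ω.1.2) + ω.2))) := by
    intro ω
    have h1 := (smoothPDF_pos ν (ω.1.1 + ω.1.2)).ne'
    have h2 := (smoothPDF_pos α (a • ω.1.2 + ω.2)).ne'
    have h3 := (isoPDF_pos one_ne_zero ω.1.2).ne'
    have h4 := (smoothPDF_pos κ (a • (ω.1.1 + ω.1.2) + ω.2)).ne'
    rw [Real.log_div (mul_ne_zero h1 h2) (mul_ne_zero h3 h4), Real.log_mul h1 h2,
      Real.log_mul h3 h4]
  -- With `Y = X + Z` and `V = aY + cZ' + U`, this ratio is the information density of `(X, V)`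
  -- divided by that of `(X, Y)`.
  have key := integral_log_nonpos P (r := fun ω =>
    smoothPDF ν (ω.1.1 + ω.1.2) * smoothPDF α (a • ω.1.2 + ω.2) /
        (isoPDF 1 ω.1.2 * smoothPDF κ (a • (ω.1.1 + ω.1.2) + ω.2))) (by fun_prop)
    (fun ω => div_pos (mul_pos (smoothPDF_pos _ _) (smoothPDF_pos _ _))
      (mul_pos (isoPDF_pos one_ne_zero _) (smoothPDF_pos _ _))) ?_ ?_
  · simp_rw [hlog] at key
    rw [integral_sub iYU iZV, integral_add iY iU, integral_add iZ iV,
      mpY.integral_comp_of_measurable (f := fun y => Real.log (smoothPDF ν y)) (by fun_prop),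
      mpZ.integral_comp_of_measurable (f := fun y => Real.log (isoPDF 1 y)) (by fun_prop),
      mpU.integral_comp_of_measurable (f := fun y => Real.log (smoothPDF α y)) (by fun_prop),
      mpV.integral_comp_of_measurable (f := fun y => Real.log (smoothPDF κ y)) (by fun_prop)]
      at key
    have hφ := integral_log_isoPDF_stdNoise (n := n)
    rw [← hγ] at hφ
    simp only [smoothEntropy, ← hγ]
    linarith
  · rw [hP, lintegral_prod _ (by fun_prop), lintegral_prod _ (by fun_prop)]
    -- For fixed `x`, cancelling the noise density and substituting `y = x + z` turns the law of `y`
    -- into `ν ∗ γ`. Then `ay + v` has law `κ ∗ γ`, its density cancels too, and a translate of the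
    -- density `smoothPDF α` remains.
    have h1 : ∀ x, ∫⁻ z, ∫⁻ v, ENNReal.ofReal (smoothPDF ν (x + z) * smoothPDF α (a • z + v) /
        (isoPDF 1 z * smoothPDF κ (a • (x + z) + v))) ∂θ ∂γ = 1 := by
      intro x
      set F : (Fin n → ℝ) → ENNReal := fun u =>
        ENNReal.ofReal (smoothPDF α (u - a • x) / smoothPDF κ u) with hF
      have hFm : Measurable F := by rw [hF]; fun_prop
      calc _ = ∫⁻ z, ENNReal.ofReal (isoPDF 1 z) *
            ∫⁻ v, ENNReal.ofReal (smoothPDF ν (x + z) * smoothPDF α (a • z + v) /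
              (isoPDF 1 z * smoothPDF κ (a • (x + z) + v))) ∂θ := lintegral_stdNoise (by fun_prop)
        _ = ∫⁻ z, ENNReal.ofReal (smoothPDF ν (x + z)) * ∫⁻ v, F (a • (x + z) + v) ∂θ := by
            refine lintegral_congr fun z => ?_
            rw [← lintegral_const_mul _ (by fun_prop), ← lintegral_const_mul _ (by fun_prop)]
            refine lintegral_congr fun v => ?_
            rw [hF, ← ENNReal.ofReal_mul (isoPDF_pos one_ne_zero _).le,
              ← ENNReal.ofReal_mul (smoothPDF_pos _ _).le]
            have h3 := (isoPDF_pos one_ne_zero z).ne'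
            have h4 := (smoothPDF_pos κ (a • (x + z) + v)).ne'
            have h5 : a • (x + z) + v - a • x = a • z + v := by rw [smul_add]; abel
            rw [h5]
            congr 1
            field_simp
        _ = ∫⁻ y, ENNReal.ofReal (smoothPDF ν y) * ∫⁻ v, F (a • y + v) ∂θ :=
            lintegral_add_left_eq_self (μ := volume)
              (fun y => ENNReal.ofReal (smoothPDF ν y) * ∫⁻ v, F (a • y + v) ∂θ) x
        _ = ∫⁻ y, ∫⁻ v, F (a • y + v) ∂θ ∂(ν ∗ γ) :=
            (lintegral_conv_stdNoise ν (by fun_prop)).symm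
        _ = ∫⁻ u, F u ∂(κ ∗ γ) := by
            rw [← hνθ, ← (measurePreserving_smul_add a (ν ∗ γ) θ).lintegral_comp hFm,
              lintegral_prod _ (by fun_prop)]
        _ = ∫⁻ u, ENNReal.ofReal (smoothPDF α (u - a • x)) := by
            rw [lintegral_conv_stdNoise _ hFm]
            refine lintegral_congr fun u => ?_
            rw [hF, ← ENNReal.ofReal_mul (smoothPDF_pos _ _).le,
              mul_div_cancel₀ _ (smoothPDF_pos _ _).ne']
        _ = 1 := by
            rw [lintegral_sub_right_eq_self (μ := volume)
              (fun u => ENNReal.ofReal (smoothPDF α u)), lintegral_smoothPDF]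
    simp only [h1, lintegral_const, measure_univ, mul_one, le_refl]
  · simp_rw [hlog]
    exact iYU.sub iZV

/-- Supplies the Jacobian `c ^ n` of the change of variables from `(Y, N)` to `(Y, aY + cN)`. -/
lemma lintegral_comp_smul_volume {c : ℝ} (hc : 0 < c) {F : (Fin n → ℝ) → ENNReal}
    (hF : Measurable F) :
    ENNReal.ofReal (c ^ n) * ∫⁻ x, F (c • x) = ∫⁻ x, F x := by
  have h := Measure.map_addHaar_smul (volume : Measure (Fin n → ℝ)) hc.ne'
  have h2 : ∫⁻ x, F x ∂(volume.map (c • · : (Fin n → ℝ) → _)) = ∫⁻ x, F (c • x) :=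
    lintegral_map hF (by fun_prop)
  have hcn : 0 < c ^ n := by positivity
  rw [← h2, h, lintegral_smul_measure, Module.finrank_fin_fun, smul_eq_mul, ← mul_assoc,
    ← ENNReal.ofReal_mul hcn.le, abs_of_pos (inv_pos.2 hcn), mul_inv_cancel₀ hcn.ne',
    ENNReal.ofReal_one, one_mul]

/-- Scaling down the signal by `a`, with `|a| < 1`, under the power constraint `Q` loses at most
as much entropy as it does for a Gaussian signal of power `Q`. -/
lemma smoothEntropy_sub_map_le (ν : Measure (Fin n → ℝ)) [HasSecondMoment ν] {a Q : ℝ}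
    (ha : a ^ 2 < 1) (hQ : 0 ≤ Q) (h : ∫ x, sqNorm x ∂ν ≤ n * Q) :
    smoothEntropy ν - smoothEntropy (ν.map (a • ·)) ≤
      n / 2 * (Real.log (1 + Q) - Real.log (1 + a ^ 2 * Q)) := by
  have hc2 : 0 < 1 - a ^ 2 := by linarith
  set c := √(1 - a ^ 2) with hc
  have hcpos : 0 < c := Real.sqrt_pos.2 hc2
  have hcsq : c ^ 2 = 1 - a ^ 2 := by rw [hc, Real.sq_sqrt hc2.le]
  have hac : a ^ 2 + c ^ 2 = 1 := by rw [hcsq]; ring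
  have hD : 0 < 1 + a ^ 2 * Q := by positivity
  -- For a signal of power exactly `Q` per coordinate, `b` is the coefficient of the best linear
  -- estimate of `Y` from `S = aY + cN`, and `v` below is the resulting mean square error.
  set b := a * (1 + Q) / (1 + a ^ 2 * Q) with hb
  set v : NNReal := ⟨(1 + Q) * c ^ 2 / (1 + a ^ 2 * Q), by positivity⟩ with hv
  have hvc : (v : ℝ) = (1 + Q) * c ^ 2 / (1 + a ^ 2 * Q) := rfl
  have hvpos : (0 : ℝ) < v := by rw [hvc]; positivity
  have hv0 : v ≠ 0 := by
    intro h0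
    rw [h0] at hvpos
    exact lt_irrefl _ hvpos
  set γ := stdNoise n with hγ
  set σ := ν.map (a • ·) with hσ
  have : HasSecondMoment γ := by rw [hγ]; infer_instance
  have : HasSecondMoment σ := by rw [hσ]; infer_instance
  set P := (ν ∗ γ).prod γ with hP
  have mpY : MeasurePreserving Prod.fst P (ν ∗ γ) := measurePreserving_fst
  have mpN : MeasurePreserving Prod.snd P γ := measurePreserving_snd
  have mpcomb : ∀ s t : ℝ, MeasurePreserving
      (fun ω : (Fin n → ℝ) × (Fin n → ℝ) => s • ω.1 + t • ω.2) P
      ((ν ∗ γ).map (s • ·) ∗ γ.map (t • ·)) := by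
    intro s t
    have h1 : MeasurePreserving (fun x : Fin n → ℝ => t • x) γ (γ.map (t • ·)) :=
      ⟨by fun_prop, rfl⟩
    exact (measurePreserving_smul_add s (ν ∗ γ) _).comp ((MeasurePreserving.id _).prod h1)
  have mpS : MeasurePreserving (fun ω : (Fin n → ℝ) × (Fin n → ℝ) => a • ω.1 + c • ω.2) P
      (σ ∗ γ) := by
    have h1 := mpcomb a c
    rwa [map_smul_conv, Measure.conv_assoc, hγ, stdNoise_map_conv_map hac] at h1
  have mpE : MeasurePreserving (fun ω : (Fin n → ℝ) × (Fin n → ℝ) =>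
      ω.1 - b • (a • ω.1 + c • ω.2)) P
      ((ν ∗ γ).map ((1 - a * b) • ·) ∗ γ.map ((-(b * c)) • ·)) := by
    convert mpcomb (1 - a * b) (-(b * c)) using 2 with ω
    ext t
    simp
    ring
  set η := (ν ∗ γ).map ((1 - a * b) • ·) ∗ γ.map ((-(b * c)) • ·) with hη
  have : HasSecondMoment η := by rw [hη]; infer_instance
  have hηm : ∫ x, sqNorm x ∂η ≤ n * v := by
    have h1 := integral_sqNorm_conv_stdNoise ν 1
    simp only [one_smul, Measure.map_id', one_pow, one_mul] at h1
    rw [hη, hγ, integral_sqNorm_conv_stdNoise,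
      integral_map (by fun_prop) measurable_sqNorm.aestronglyMeasurable]
    simp_rw [sqNorm_smul]
    rw [integral_const_mul, h1]
    -- With `b` fixed, the error is nondecreasing in the signal power, so full power is the worst
    -- case.
    have h2 : (1 - a * b) ^ 2 * (∫ x, sqNorm x ∂ν + n) ≤ (1 - a * b) ^ 2 * (n * Q + n) := by
      gcongr
    have h3 : (1 - a * b) ^ 2 * (n * Q + n) + (-(b * c)) ^ 2 * n = n * v := by
      have h4 : 1 - a * b = c ^ 2 / (1 + a ^ 2 * Q) := by
        rw [hb, hcsq]; field_simp; ring
      rw [h4, hvc, neg_sq, mul_pow, hb]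
      field_simp
      rw [hcsq]
      ring
    linarith
  have iY := mpY.integrable_comp_of_integrable (integrable_log_smoothPDF ν (ν ∗ γ))
  have iN := mpN.integrable_comp_of_integrable (integrable_log_isoPDF one_ne_zero γ)
  have iS := mpS.integrable_comp_of_integrable (integrable_log_smoothPDF σ (σ ∗ γ))
  have iE := mpE.integrable_comp_of_integrable (integrable_log_isoPDF hv0 η)
  simp only [Function.comp_def] at iY iN iS iE
  have iCE : Integrable (fun ω : (Fin n → ℝ) × (Fin n → ℝ) =>
      n * Real.log c + Real.log (isoPDF v (ω.1 - b • (a • ω.1 + c • ω.2)))) P :=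
    (integrable_const _).add iE
  have iCES : Integrable (fun ω : (Fin n → ℝ) × (Fin n → ℝ) =>
      n * Real.log c + Real.log (isoPDF v (ω.1 - b • (a • ω.1 + c • ω.2))) +
        Real.log (smoothPDF σ (a • ω.1 + c • ω.2))) P := iCE.add iS
  have iYN : Integrable (fun ω : (Fin n → ℝ) × (Fin n → ℝ) =>
      Real.log (smoothPDF ν ω.1) + Real.log (isoPDF 1 ω.2)) P := iY.add iN
  have hlog : ∀ ω : (Fin n → ℝ) × (Fin n → ℝ),
      Real.log (c ^ n * isoPDF v (ω.1 - b • (a • ω.1 + c • ω.2)) *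
        smoothPDF σ (a • ω.1 + c • ω.2) / (smoothPDF ν ω.1 * isoPDF 1 ω.2)) =
      n * Real.log c + Real.log (isoPDF v (ω.1 - b • (a • ω.1 + c • ω.2))) +
        Real.log (smoothPDF σ (a • ω.1 + c • ω.2)) -
        (Real.log (smoothPDF ν ω.1) + Real.log (isoPDF 1 ω.2)) := by
    intro ω
    have h0 : c ^ n ≠ 0 := by positivity
    have h1 := (isoPDF_pos hv0 (ω.1 - b • (a • ω.1 + c • ω.2))).ne'
    have h2 := (smoothPDF_pos σ (a • ω.1 + c • ω.2)).ne'
    have h3 := (smoothPDF_pos ν ω.1).ne'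
    have h4 := (isoPDF_pos one_ne_zero ω.2).ne'
    rw [Real.log_div (mul_ne_zero (mul_ne_zero h0 h1) h2) (mul_ne_zero h3 h4),
      Real.log_mul (mul_ne_zero h0 h1) h2, Real.log_mul h0 h1, Real.log_mul h3 h4, Real.log_pow]
  -- Chain rule: the joint density of `(Y, S)` is `f(Y) φ(N) / c ^ n`. It is compared with the
  -- density of `S` times a Gaussian conditional law of `Y` with mean `bS` and variance `v`, which
  -- encodes `h(Y | S) ≤ h(Y - bS)` and the Gaussian bound at once.
  have key := integral_log_nonpos P (r := fun ω =>
    c ^ n * isoPDF v (ω.1 - b • (a • ω.1 + c • ω.2)) *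
        smoothPDF σ (a • ω.1 + c • ω.2) / (smoothPDF ν ω.1 * isoPDF 1 ω.2)) (by fun_prop)
    (fun ω => div_pos (mul_pos (mul_pos (by positivity) (isoPDF_pos hv0 _)) (smoothPDF_pos _ _))
      (mul_pos (smoothPDF_pos _ _) (isoPDF_pos one_ne_zero _))) ?_ ?_
  · simp_rw [hlog] at key
    rw [integral_sub iCES iYN, integral_add iCE iS, integral_add (integrable_const _) iE,
      integral_add iY iN,
      mpY.integral_comp_of_measurable (f := fun y => Real.log (smoothPDF ν y)) (by fun_prop),
      mpN.integral_comp_of_measurable (f := fun y => Real.log (isoPDF 1 y)) (by fun_prop),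
      mpE.integral_comp_of_measurable (f := fun y => Real.log (isoPDF v y)) (by fun_prop),
      mpS.integral_comp_of_measurable (f := fun y => Real.log (smoothPDF σ y)) (by fun_prop)]
      at key
    have hφ := integral_log_isoPDF_stdNoise (n := n)
    rw [← hγ] at hφ
    have hg : -(n / 2 * Real.log (2 * Real.pi * v)) - n / 2 ≤
        ∫ y, Real.log (isoPDF v y) ∂η := by
      simp_rw [log_isoPDF hv0]
      rw [integral_sub (integrable_const _) ((integrable_sqNorm _).div_const _), integral_div]
      have h2 : (∫ x, sqNorm x ∂η) / (2 * v) ≤ n / 2 := by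
        rw [div_le_div_iff₀ (by positivity) (by positivity)]
        linarith
      simp only [integral_const, probReal_univ, smul_eq_mul, one_mul]
      linarith
    have hlv : Real.log (2 * Real.pi * v) = Real.log (2 * Real.pi) + Real.log (1 + Q) +
        2 * Real.log c - Real.log (1 + a ^ 2 * Q) := by
      have h5 : Real.log ((1 + Q) * c ^ 2) = Real.log (1 + Q) + 2 * Real.log c := by
        rw [Real.log_mul (by positivity) (by positivity), Real.log_pow]
        norm_num
      rw [Real.log_mul (by positivity) hvpos.ne', hvc, Real.log_div (by positivity) hD.ne', h5]
      ring
    rw [hlv] at hg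
    simp only [integral_const, probReal_univ, smul_eq_mul, one_mul] at key
    simp only [smoothEntropy, ← hγ]
    linarith
  · rw [hP, lintegral_prod _ (by fun_prop), lintegral_conv_stdNoise _ (by fun_prop)]
    set G : (Fin n → ℝ) → (Fin n → ℝ) → ENNReal := fun y s =>
      ENNReal.ofReal (isoPDF v (y - b • s)) * ENNReal.ofReal (smoothPDF σ s) with hG
    have hGm : ∀ y, Measurable (G y) := fun y => by simp only [hG]; fun_prop
    -- For fixed `y`, substitute `s = ay + cN`; the factor `c ^ n` absorbs the Jacobian.
    have h1 : ∀ y, ENNReal.ofReal (smoothPDF ν y) * ∫⁻ N, ENNReal.ofReal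
        (c ^ n * isoPDF v (y - b • (a • y + c • N)) * smoothPDF σ (a • y + c • N) /
          (smoothPDF ν y * isoPDF 1 N)) ∂γ = ∫⁻ s, G y s := by
      intro y
      have hGy := hGm y
      rw [← lintegral_add_left_eq_self (μ := volume) (fun s => G y s) (a • y),
        ← lintegral_comp_smul_volume hcpos (F := fun u => G y (a • y + u)) (by fun_prop),
        ← lintegral_const_mul _ (by fun_prop), ← lintegral_const_mul _ (by fun_prop), hγ,
        lintegral_stdNoise (by fun_prop)]
      refine lintegral_congr fun N => ?_
      have h3 := (smoothPDF_pos ν y).ne'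
      have h4 := (isoPDF_pos one_ne_zero N).ne'
      simp only [hG]
      rw [← ENNReal.ofReal_mul (isoPDF_pos hv0 _).le, ← ENNReal.ofReal_mul (pow_pos hcpos n).le,
        ← ENNReal.ofReal_mul (smoothPDF_pos _ _).le,
        ← ENNReal.ofReal_mul (isoPDF_pos one_ne_zero _).le]
      congr 1
      field_simp
    simp_rw [h1]
    rw [lintegral_lintegral_swap (by simp only [hG]; fun_prop)]
    have h2 : ∀ s, ∫⁻ y, G y s = ENNReal.ofReal (smoothPDF σ s) := by
      intro s
      simp only [hG]
      rw [lintegral_mul_const _ (by fun_prop), lintegral_sub_right_eq_self (μ := volume)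
        (fun y => ENNReal.ofReal (isoPDF v y)), lintegral_isoPDF hv0, one_mul]
    simp_rw [h2]
    rw [lintegral_smoothPDF]
  · simp_rw [hlog]
    exact iCES.sub iYN

/-! ### Uniform mixtures. -/

/-- The uniform mixture of a finite family of measures. -/
noncomputable def avgMeasure {ι α : Type*} [Fintype ι] [MeasurableSpace α] (ν : ι → Measure α) :
    Measure α :=
  (Fintype.card ι : ENNReal)⁻¹ • ∑ i, ν i

section avg

variable {ι α β : Type*} [Fintype ι] [MeasurableSpace α] [MeasurableSpace β]

lemma lintegral_avgMeasure (ν : ι → Measure α) (f : α → ENNReal) :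
    ∫⁻ x, f x ∂avgMeasure ν = (Fintype.card ι : ENNReal)⁻¹ * ∑ i, ∫⁻ x, f x ∂ν i := by
  rw [avgMeasure, lintegral_smul_measure, lintegral_finsetSum_measure, smul_eq_mul]

lemma integrable_avgMeasure [Nonempty ι] {ν : ι → Measure α} {f : α → ℝ} :
    Integrable f (avgMeasure ν) ↔ ∀ i, Integrable f (ν i) := by
  rw [avgMeasure, integrable_smul_measure (by simp) (by simp), integrable_finsetSum_measure]
  simp

lemma integral_avgMeasure {ν : ι → Measure α} {f : α → ℝ} (hf : ∀ i, Integrable f (ν i)) :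
    ∫ x, f x ∂avgMeasure ν = (Fintype.card ι : ℝ)⁻¹ * ∑ i, ∫ x, f x ∂ν i := by
  rw [avgMeasure, integral_smul_measure, integral_finsetSum_measure fun i _ => hf i]
  simp

instance isProbabilityMeasure_avgMeasure [Nonempty ι] (ν : ι → Measure α)
    [∀ i, IsProbabilityMeasure (ν i)] : IsProbabilityMeasure (avgMeasure ν) := by
  refine ⟨?_⟩
  rw [← lintegral_one, lintegral_avgMeasure]
  simp only [lintegral_one, measure_univ, Finset.sum_const, Finset.card_univ, nsmul_eq_mul,
    mul_one]
  exact ENNReal.inv_mul_cancel (by simp) (by simp)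

instance hasSecondMoment_avgMeasure [Nonempty ι] (ν : ι → Measure (Fin n → ℝ))
    [∀ i, HasSecondMoment (ν i)] : HasSecondMoment (avgMeasure ν) where
  integrable_sq := integrable_avgMeasure.2 fun i => integrable_sqNorm (ν i)

lemma map_avgMeasure (ν : ι → Measure α) {f : α → β} (hf : Measurable f) :
    (avgMeasure ν).map f = avgMeasure fun i => (ν i).map f := by
  refine Measure.ext_of_lintegral _ fun g hg => ?_
  simp only [lintegral_map hg hf, lintegral_avgMeasure]

lemma avgMeasure_conv (ν : ι → Measure (Fin n → ℝ)) (μ : Measure (Fin n → ℝ)) [SFinite μ] :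
    avgMeasure ν ∗ μ = avgMeasure fun i => ν i ∗ μ := by
  refine Measure.ext_of_lintegral _ fun g hg => ?_
  simp only [Measure.lintegral_conv hg, lintegral_avgMeasure]

lemma lintegral_uniformOn [Nonempty ι] [MeasurableSpace ι] [MeasurableSingletonClass ι]
    (f : ι → ENNReal) :
    ∫⁻ i, f i ∂uniformOn (Set.univ : Set ι) = (Fintype.card ι : ENNReal)⁻¹ * ∑ i, f i := by
  have : ∀ i : ι, uniformOn (Set.univ : Set ι) {i} = (Fintype.card ι : ENNReal)⁻¹ := by
    intro i
    rw [uniformOn_univ]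
    simp
  rw [lintegral_fintype, Finset.mul_sum]
  simp_rw [this, mul_comm]

end avg

/-! ### Mutual information with a uniform index: Fano and relative entropy. -/

/-- The information between a uniform index `i` and an observation `Y`, in nats, when `Y` has the
law `ν i ∗ stdNoise n` given `i`. -/
noncomputable def smoothInfo {ι : Type*} [Fintype ι] (ν : ι → Measure (Fin n → ℝ)) : ℝ :=
  smoothEntropy (avgMeasure ν) - (Fintype.card ι : ℝ)⁻¹ * ∑ i, smoothEntropy (ν i)

/-- The entropy of the mixture is an average over the component laws, so both logarithms can be
integrated under the same law: the information is a mean log-likelihood ratio. -/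
lemma smoothInfo_eq {ι : Type*} [Fintype ι] [Nonempty ι] (ν : ι → Measure (Fin n → ℝ))
    [∀ i, HasSecondMoment (ν i)] :
    smoothInfo ν = (Fintype.card ι : ℝ)⁻¹ * ∑ i, (∫ y, Real.log (smoothPDF (ν i) y)
      ∂(ν i ∗ stdNoise n) - ∫ y, Real.log (smoothPDF (avgMeasure ν) y) ∂(ν i ∗ stdNoise n)) := by
  simp only [smoothInfo, smoothEntropy]
  rw [avgMeasure_conv, integral_avgMeasure fun i => integrable_log_smoothPDF _ _,
    Finset.sum_sub_distrib, Finset.sum_neg_distrib]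
  ring

/-- Fano's inequality for list decoding: if `i` is uniform on a set of `M` elements and belongs to
a list of at most `ℓ` candidates computed from `Y` except with probability `p`, then
`I(i; Y) ≥ (1 - p) log M - log ℓ - log 2`. -/
lemma le_smoothInfo_of_list {ι : Type*} [Fintype ι] [Nonempty ι] (ν : ι → Measure (Fin n → ℝ))
    [∀ i, HasSecondMoment (ν i)] (S : ι → Set (Fin n → ℝ)) (hS : ∀ i, MeasurableSet (S i))
    {ℓ : ℕ} (hℓ : 0 < ℓ) (hcard : ∀ y, {i | y ∈ S i}.ncard ≤ ℓ) {p : ℝ}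
    (hp : (Fintype.card ι : ℝ)⁻¹ * ∑ i, (ν i ∗ stdNoise n).real (S i)ᶜ ≤ p) :
    (1 - p) * Real.log (Fintype.card ι) - Real.log ℓ - Real.log 2 ≤ smoothInfo ν := by
  classical
  set M : ℕ := Fintype.card ι with hM
  have hM0 : 0 < M := Fintype.card_pos
  have hMr : (0 : ℝ) < M := by exact_mod_cast hM0
  have hℓr : (0 : ℝ) < ℓ := by exact_mod_cast hℓ
  set L : ℝ := Real.log M - Real.log ℓ with hL
  -- A score for each candidate, large on the list. Its sum over `i` is at most `ℓ · M/(2ℓ) + M/2 =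
  -- M`, so `q i y / M` is a subprobability guess of the posterior; the factors 2 cost the `log 2`
  -- in the bound.
  set q : ι → (Fin n → ℝ) → ℝ := fun i y => if y ∈ S i then (M : ℝ) / (2 * ℓ) else 1 / 2 with hq
  have hqm : ∀ i, Measurable (q i) := fun i =>
    Measurable.ite (hS i) measurable_const measurable_const
  have hqpos : ∀ i y, 0 < q i y := by
    intro i y
    simp only [hq]
    split_ifs <;> positivity
  have hqlog : ∀ i y, Real.log (q i y) = (S i).indicator (fun _ => L) y - Real.log 2 := by
    intro i y
    simp only [hq]
    split_ifs with hy
    · rw [Set.indicator_of_mem hy, Real.log_div (by positivity) (by positivity),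
        Real.log_mul (by positivity) (by positivity)]
      ring
    · rw [Set.indicator_of_notMem hy, one_div, Real.log_inv]
      ring
  have hqsum : ∀ y, ∑ i, q i y ≤ M := by
    intro y
    have h1 : ∀ i, q i y ≤ (if y ∈ S i then (M : ℝ) / (2 * ℓ) else 0) + 1 / 2 := by
      intro i
      simp only [hq]
      split_ifs <;> simp
    refine (Finset.sum_le_sum fun i _ => h1 i).trans ?_
    rw [Finset.sum_add_distrib, ← Finset.sum_filter, Finset.sum_const, Finset.sum_const,
      Finset.card_univ, ← hM, nsmul_eq_mul, nsmul_eq_mul]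
    have h2 : ((Finset.univ.filter fun i => y ∈ S i).card : ℝ) ≤ ℓ := by
      have := hcard y
      rw [Set.ncard_eq_toFinset_card'] at this
      simp only [Set.toFinset_ofPred] at this
      exact_mod_cast this
    calc _ ≤ (ℓ : ℝ) * (M / (2 * ℓ)) + M * (1 / 2) := by gcongr
      _ = M := by field_simp; ring
  set κ := avgMeasure ν with hκ
  have i1 : ∀ i, Integrable (fun y => Real.log (q i y)) (ν i ∗ stdNoise n) := by
    intro i
    simp_rw [hqlog]
    exact ((integrable_const L).indicator (hS i)).sub (integrable_const _)
  have i2 := fun i => integrable_log_smoothPDF κ (ν i ∗ stdNoise n)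
  have i3 := fun i => integrable_log_smoothPDF (ν i) (ν i ∗ stdNoise n)
  have i12 : ∀ i, Integrable (fun y => Real.log (q i y) + Real.log (smoothPDF κ y))
    (ν i ∗ stdNoise n) := fun i => (i1 i).add (i2 i)
  have hlog : ∀ i y, Real.log (q i y * smoothPDF κ y / smoothPDF (ν i) y) =
      Real.log (q i y) + Real.log (smoothPDF κ y) - Real.log (smoothPDF (ν i) y) := by
    intro i y
    rw [Real.log_div (mul_pos (hqpos i y) (smoothPDF_pos κ y)).ne' (smoothPDF_pos _ _).ne',
      Real.log_mul (hqpos i y).ne' (smoothPDF_pos κ y).ne']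
  have key := sum_integral_log_nonpos (fun i => ν i ∗ stdNoise n)
    (r := fun i y => q i y * smoothPDF κ y / smoothPDF (ν i) y)
    (fun i => by have := hqm i; fun_prop)
    (fun i => ae_of_all _ fun y =>
      div_pos (mul_pos (hqpos i y) (smoothPDF_pos κ y)) (smoothPDF_pos _ _)) ?_ ?_
  · simp_rw [hlog] at key
    have h1 : ∀ i, ∫ y, (Real.log (q i y) + Real.log (smoothPDF κ y) -
        Real.log (smoothPDF (ν i) y)) ∂(ν i ∗ stdNoise n) =
        (L - L * (ν i ∗ stdNoise n).real (S i)ᶜ - Real.log 2) -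
        (∫ y, Real.log (smoothPDF (ν i) y) ∂(ν i ∗ stdNoise n) -
          ∫ y, Real.log (smoothPDF κ y) ∂(ν i ∗ stdNoise n)) := by
      intro i
      rw [integral_sub (i12 i) (i3 i), integral_add (i1 i) (i2 i)]
      simp_rw [hqlog]
      rw [integral_sub ((integrable_const L).indicator (hS i)) (integrable_const _),
        integral_indicator_const _ (hS i), probReal_compl_eq_one_sub (hS i)]
      simp
      ring
    simp_rw [h1] at key
    rw [Finset.sum_sub_distrib, Finset.sum_sub_distrib, Finset.sum_sub_distrib,
      ← Finset.mul_sum, Finset.sum_const, Finset.sum_const, Finset.card_univ, ← hM,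
      nsmul_eq_mul, nsmul_eq_mul] at key
    have h2 := mul_le_mul_of_nonneg_left key (inv_nonneg.2 hMr.le)
    rw [smoothInfo_eq, ← hM, ← hκ]
    set T := ∑ i, (∫ y, Real.log (smoothPDF (ν i) y) ∂(ν i ∗ stdNoise n) -
          ∫ y, Real.log (smoothPDF κ y) ∂(ν i ∗ stdNoise n))
    set p' := (M : ℝ)⁻¹ * ∑ i, (ν i ∗ stdNoise n).real (S i)ᶜ with hp'
    have h3 : (M : ℝ)⁻¹ * (M * L - L * ∑ i, (ν i ∗ stdNoise n).real (S i)ᶜ - M * Real.log 2 - T)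
        = L - L * p' - Real.log 2 - (M : ℝ)⁻¹ * T := by
      rw [hp']; field_simp
    rw [h3, mul_zero] at h2
    have h4 : 0 ≤ p' := by positivity
    have h5 : 0 ≤ Real.log M := Real.log_natCast_nonneg M
    have h6 : 0 ≤ Real.log ℓ := Real.log_natCast_nonneg ℓ
    have h7 : p' * Real.log M ≤ p * Real.log M := mul_le_mul_of_nonneg_right hp h5
    have h8 : 0 ≤ p' * Real.log ℓ := mul_nonneg h4 h6
    rw [hL] at h2
    nlinarith
  · have h1 : ∀ i, ∫⁻ y, ENNReal.ofReal (q i y * smoothPDF κ y / smoothPDF (ν i) y)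
        ∂(ν i ∗ stdNoise n) = ∫⁻ y, ENNReal.ofReal (q i y) * ENNReal.ofReal (smoothPDF κ y) := by
      intro i
      have := hqm i
      rw [lintegral_conv_stdNoise _ (by fun_prop)]
      refine lintegral_congr fun y => ?_
      rw [← ENNReal.ofReal_mul (smoothPDF_pos _ _).le, ← ENNReal.ofReal_mul (hqpos i y).le,
        mul_div_cancel₀ _ (smoothPDF_pos _ _).ne']
    simp_rw [h1]
    rw [← lintegral_finsetSum _ fun i _ => by have := hqm i; fun_prop]
    calc ∫⁻ y, ∑ i, ENNReal.ofReal (q i y) * ENNReal.ofReal (smoothPDF κ y)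
        ≤ ∫⁻ y, (M : ENNReal) * ENNReal.ofReal (smoothPDF κ y) := by
          refine lintegral_mono fun y => ?_
          rw [← Finset.sum_mul, ← ENNReal.ofReal_sum_of_nonneg fun i _ => (hqpos i y).le]
          gcongr
          exact (ENNReal.ofReal_le_ofReal (hqsum y)).trans (by simp)
      _ = M := by rw [lintegral_const_mul _ (by fun_prop), lintegral_smoothPDF, mul_one]
  · intro i
    simp_rw [hlog]
    exact (i12 i).sub (i3 i)

/-- The Gibbs variational lower bound for the relative entropy. -/
lemma integral_log_le_toReal_klDiv {Ω : Type*} [MeasurableSpace Ω] {P Q : Measure Ω}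
    [IsProbabilityMeasure P] [IsProbabilityMeasure Q]
    (h : InformationTheory.klDiv P Q ≠ ⊤) {r : Ω → ℝ} (hm : Measurable r) (hpos : ∀ ω, 0 < r ω)
    (hr : ∫⁻ ω, ENNReal.ofReal (r ω) ∂Q ≤ 1) (hi : Integrable (fun ω => Real.log (r ω)) P) :
    ∫ ω, Real.log (r ω) ∂P ≤ (InformationTheory.klDiv P Q).toReal := by
  obtain ⟨hac, hllr⟩ := InformationTheory.klDiv_ne_top_iff.1 h
  have hD : ∀ᵐ ω ∂P, 0 < (P.rnDeriv Q ω).toReal := by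
    filter_upwards [Measure.rnDeriv_pos hac, hac.ae_le (Measure.rnDeriv_ne_top P Q)] with ω h1 h2
    exact ENNReal.toReal_pos h1.ne' h2
  have hlog : (fun ω => Real.log (r ω / (P.rnDeriv Q ω).toReal)) =ᵐ[P]
      fun ω => Real.log (r ω) - llr P Q ω := by
    filter_upwards [hD] with ω hω
    rw [Real.log_div (hpos ω).ne' hω.ne', llr]
  -- Gibbs for `r / (dP/dQ)`: its `P`-integral is that of `r` under `Q` where `dP/dQ ≠ 0`, hence at
  -- most 1. Positivity of `dP/dQ` holds only `P`-almost everywhere.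
  have key := sum_integral_log_nonpos (ι := Unit) (fun _ => P)
    (r := fun _ ω => r ω / (P.rnDeriv Q ω).toReal) (fun _ => by fun_prop)
    (fun _ => by
      filter_upwards [hD] with ω hω
      exact div_pos (hpos ω) hω) ?_ ?_
  · simp only [Finset.univ_unique, Finset.sum_const, Finset.card_singleton, one_smul] at key
    rw [integral_congr_ae hlog, integral_sub hi hllr] at key
    rw [InformationTheory.toReal_klDiv_of_measure_eq hac (by simp)]
    linarith
  · simp only [Finset.univ_unique, Finset.sum_const, Finset.card_singleton, one_smul,
      Fintype.card_unit, Nat.cast_one]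
    refine le_trans ?_ hr
    rw [← lintegral_rnDeriv_mul hac (by fun_prop)]
    refine lintegral_mono_ae ?_
    filter_upwards [Measure.rnDeriv_ne_top P Q] with ω hω
    by_cases h0 : P.rnDeriv Q ω = 0
    · simp [h0]
    · have h1 : 0 < (P.rnDeriv Q ω).toReal := ENNReal.toReal_pos h0 hω
      nth_rewrite 1 [← ENNReal.ofReal_toReal hω]
      rw [← ENNReal.ofReal_mul h1.le, mul_div_cancel₀ _ h1.ne']
  · intro _
    exact (integrable_congr hlog).2 (hi.sub hllr)

/-- The entropy expression of the information is at most the relative entropy between the joint law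
and the product of the marginal laws. -/
lemma smoothInfo_le_klDiv {ι : Type*} [Fintype ι] [Nonempty ι] [MeasurableSpace ι]
    [MeasurableSingletonClass ι] (ν : ι → Measure (Fin n → ℝ)) [∀ i, HasSecondMoment (ν i)]
    (h : InformationTheory.klDiv (avgMeasure fun i => (Measure.dirac i).prod (ν i ∗ stdNoise n))
      ((avgMeasure Measure.dirac).prod (avgMeasure ν ∗ stdNoise n)) ≠ ⊤) :
    smoothInfo ν ≤ (InformationTheory.klDiv
      (avgMeasure fun i => (Measure.dirac i).prod (ν i ∗ stdNoise n))
      ((avgMeasure Measure.dirac).prod (avgMeasure ν ∗ stdNoise n))).toReal := by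
  set κ := avgMeasure ν with hκ
  set J : Measure (ι × (Fin n → ℝ)) :=
    avgMeasure fun i => (Measure.dirac i).prod (ν i ∗ stdNoise n) with hJ
  -- The likelihood ratio of the joint law to the product law is the test function; only this
  -- direction is needed to use the secrecy constraint.
  set r : ι × (Fin n → ℝ) → ℝ := fun p => smoothPDF (ν p.1) p.2 / smoothPDF κ p.2 with hr
  have hrm : Measurable r := by
    refine measurable_from_prod_countable_right fun i => ?_
    simp only [hr]
    fun_prop
  have hlog : ∀ i y, Real.log (r (i, y)) =
      Real.log (smoothPDF (ν i) y) - Real.log (smoothPDF κ y) := fun i y =>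
    Real.log_div (smoothPDF_pos _ _).ne' (smoothPDF_pos _ _).ne'
  have i1 := fun i => integrable_log_smoothPDF (ν i) (ν i ∗ stdNoise n)
  have i2 := fun i => integrable_log_smoothPDF κ (ν i ∗ stdNoise n)
  have hint : ∀ i, Integrable (fun p => Real.log (r p))
      ((Measure.dirac i).prod (ν i ∗ stdNoise n)) := by
    intro i
    rw [Measure.dirac_prod, integrable_map_measure hrm.log.aestronglyMeasurable (by fun_prop)]
    simp only [Function.comp_def, hlog]
    exact (i1 i).sub (i2 i)
  have key := integral_log_le_toReal_klDiv h hrm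
    (fun p => div_pos (smoothPDF_pos _ _) (smoothPDF_pos _ _)) ?_ (integrable_avgMeasure.2 hint)
  · rw [integral_avgMeasure hint] at key
    rw [smoothInfo_eq]
    refine le_trans (le_of_eq ?_) key
    congr 1
    refine Finset.sum_congr rfl fun i _ => ?_
    rw [Measure.dirac_prod, integral_map (by fun_prop) hrm.log.aestronglyMeasurable]
    simp only [hlog]
    rw [integral_sub (i1 i) (i2 i)]
  · rw [lintegral_prod _ (by fun_prop), lintegral_avgMeasure]
    have h1 : ∀ i, ∫⁻ y, ENNReal.ofReal (r (i, y)) ∂(κ ∗ stdNoise n) = 1 := by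
      intro i
      rw [lintegral_conv_stdNoise _ (by fun_prop), ← lintegral_smoothPDF (ν i)]
      refine lintegral_congr fun y => ?_
      rw [← ENNReal.ofReal_mul (smoothPDF_pos _ _).le, hr,
        mul_div_cancel₀ _ (smoothPDF_pos _ _).ne']
    simp only [lintegral_dirac, h1, Finset.sum_const, Finset.card_univ, nsmul_eq_mul, mul_one]
    exact ENNReal.inv_mul_le_one _

/-! ### Joint laws of an index and an observation. -/

lemma avgMeasure_prod {ι κ α : Type*} [Fintype ι] [Fintype κ] [MeasurableSpace α]
    (ν : ι × κ → Measure α) :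
    (avgMeasure fun i => avgMeasure fun k => ν (i, k)) = avgMeasure ν := by
  refine Measure.ext_of_lintegral _ fun g _ => ?_
  simp only [lintegral_avgMeasure, Fintype.card_prod, Nat.cast_mul, Fintype.sum_prod_type]
  rw [← Finset.mul_sum, ← mul_assoc, ENNReal.mul_inv (by simp) (by simp)]

lemma map_fst_avgMeasure_dirac_prod {ι : Type*} [Fintype ι] [MeasurableSpace ι]
    (ρ : ι → Measure (Fin n → ℝ)) [∀ i, IsProbabilityMeasure (ρ i)] :
    (avgMeasure fun i => (Measure.dirac i).prod (ρ i)).map Prod.fst =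
      avgMeasure Measure.dirac := by
  rw [map_avgMeasure _ measurable_fst]
  simp

lemma map_snd_avgMeasure_dirac_prod {ι : Type*} [Fintype ι] [MeasurableSpace ι]
    (ρ : ι → Measure (Fin n → ℝ)) [∀ i, IsProbabilityMeasure (ρ i)] :
    (avgMeasure fun i => (Measure.dirac i).prod (ρ i)).map Prod.snd = avgMeasure ρ := by
  rw [map_avgMeasure _ measurable_snd]
  simp

lemma lintegral_avgMeasure_dirac_prod {ι : Type*} [Fintype ι] [MeasurableSpace ι]
    (ρ : ι → Measure (Fin n → ℝ)) [∀ i, IsProbabilityMeasure (ρ i)]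
    {F : ι × (Fin n → ℝ) → ENNReal} (hF : Measurable F) :
    ∫⁻ p, F p ∂(avgMeasure fun i => (Measure.dirac i).prod (ρ i)) =
      (Fintype.card ι : ENNReal)⁻¹ * ∑ i, ∫⁻ y, F (i, y) ∂ρ i := by
  rw [lintegral_avgMeasure]
  congr 1
  refine Finset.sum_congr rfl fun i _ => ?_
  rw [Measure.dirac_prod, lintegral_map hF (by fun_prop)]

/-- Each index has positive weight, so a power constraint on the mixture makes every conditional
second moment finite, though not bounded by `D`. -/
lemma hasSecondMoment_of_lintegral_avgMeasure_le {ι : Type*} [Fintype ι] [Nonempty ι]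
    (ν : ι → Measure (Fin n → ℝ)) [∀ i, IsProbabilityMeasure (ν i)] {D : ℝ} (hD : 0 ≤ D)
    (h : ∫⁻ x, ENNReal.ofReal (sqNorm x) ∂avgMeasure ν ≤ ENNReal.ofReal D) :
    (∀ i, HasSecondMoment (ν i)) ∧ ∫ x, sqNorm x ∂avgMeasure ν ≤ D := by
  have h1 : Integrable sqNorm (avgMeasure ν) :=
    (lintegral_ofReal_ne_top_iff_integrable measurable_sqNorm.aestronglyMeasurable
      (ae_of_all _ sqNorm_nonneg)).1 (h.trans_lt ENNReal.ofReal_lt_top).ne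
  refine ⟨fun i => ⟨integrable_avgMeasure.1 h1 i⟩, ?_⟩
  rw [integral_eq_lintegral_of_nonneg_ae (ae_of_all _ sqNorm_nonneg)
    measurable_sqNorm.aestronglyMeasurable]
  exact ENNReal.toReal_le_of_le_ofReal hD h

/-! ### Conditional laws of the channel outputs. -/

namespace ZICOutcome

variable {M1 M2 L : ℕ}

@[fun_prop] lemma measurable_W1 : Measurable (W1 (n := n) (M1 := M1) (M2 := M2) (L := L)) := by
  unfold W1; fun_prop

@[fun_prop] lemma measurable_W2 : Measurable (W2 (n := n) (M1 := M1) (M2 := M2) (L := L)) := by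
  unfold W2; fun_prop

@[fun_prop] lemma measurable_X1 : Measurable (X1 (n := n) (M1 := M1) (M2 := M2) (L := L)) := by
  unfold X1; fun_prop

@[fun_prop] lemma measurable_X2 : Measurable (X2 (n := n) (M1 := M1) (M2 := M2) (L := L)) := by
  unfold X2; fun_prop

lemma Y1_eq (ch : GaussianZIC) (ω : ZICOutcome n M1 M2 L) :
    ω.Y1 ch = ch.h11 • ω.1.1.2 + ch.h21 • ω.1.2.2 + ω.2.1 := rfl

lemma Y2_eq (ch : GaussianZIC) (ω : ZICOutcome n M1 M2 L) :
    ω.Y2 ch = ch.h22 • ω.1.2.2 + ω.2.2 := rfl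

@[fun_prop] lemma measurable_Y1 (ch : GaussianZIC) :
    Measurable (Y1 (n := n) (M1 := M1) (M2 := M2) (L := L) ch) := by
  simp only [funext (Y1_eq ch)]
  fun_prop

@[fun_prop] lemma measurable_Y2 (ch : GaussianZIC) :
    Measurable (Y2 (n := n) (M1 := M1) (M2 := M2) (L := L) ch) := by
  simp only [funext (Y2_eq ch)]
  fun_prop

end ZICOutcome

namespace ZICCode

variable {M1 M2 L : ℕ} (C : ZICCode n M1 M2 L)

instance isMarkovKernel_enc1 : IsMarkovKernel C.enc1 := C.enc1_markov

instance isMarkovKernel_enc2 : IsMarkovKernel C.enc2 := C.enc2_markov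

variable (hd : ℝ)

/-- The law of `hd X₁` given `W₁ = w`. -/
noncomputable def signal1 (w : Fin M1) : Measure (Fin n → ℝ) := (C.enc1 w).map (hd • ·)

/-- The law of `hd X₂` given `W₂ = w`. -/
noncomputable def signal2 (w : Fin M2) : Measure (Fin n → ℝ) :=
  avgMeasure fun k : Fin L => (C.enc2 (w, k)).map (hd • ·)

lemma avgMeasure_signal1 :
    avgMeasure (C.signal1 hd) = (avgMeasure fun w => C.enc1 w).map (hd • ·) := by
  rw [map_avgMeasure _ (by fun_prop)]
  rfl

lemma avgMeasure_signal2 :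
    avgMeasure (C.signal2 hd) = (avgMeasure fun p => C.enc2 p).map (hd • ·) := by
  rw [map_avgMeasure _ (by fun_prop), ← avgMeasure_prod]
  rfl

lemma lintegral_uniformOn_compProd {ι α : Type*} [Fintype ι] [Nonempty ι] [MeasurableSpace ι]
    [MeasurableSingletonClass ι] [MeasurableSpace α] (κ : Kernel ι α) [IsMarkovKernel κ]
    {F : ι × α → ENNReal} (hF : Measurable F) :
    ∫⁻ p, F p ∂(uniformOn (Set.univ : Set ι) ⊗ₘ κ) =
      (Fintype.card ι : ENNReal)⁻¹ * ∑ i, ∫⁻ x, F (i, x) ∂κ i := by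
  have : IsProbabilityMeasure (uniformOn (Set.univ : Set ι)) :=
    isProbabilityMeasure_uniformOn Set.finite_univ Set.univ_nonempty
  rw [Measure.lintegral_compProd hF, lintegral_uniformOn]

instance isProbabilityMeasure_uniformOn_univ {ι : Type*} [Fintype ι] [Nonempty ι]
    [MeasurableSpace ι] [MeasurableSingletonClass ι] :
    IsProbabilityMeasure (uniformOn (Set.univ : Set ι)) :=
  isProbabilityMeasure_uniformOn Set.finite_univ Set.univ_nonempty

variable [NeZero M1] [NeZero M2] [NeZero L]

instance : IsProbabilityMeasure C.law := by
  unfold law; infer_instance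

lemma lintegral_law {F : ZICOutcome n M1 M2 L → ENNReal} (hF : Measurable F) :
    ∫⁻ ω, F ω ∂C.law = (Fintype.card (Fin M1) : ENNReal)⁻¹ * ∑ w, ∫⁻ x,
      (Fintype.card (Fin M2 × Fin L) : ENNReal)⁻¹ * ∑ p, ∫⁻ x', ∫⁻ z, ∫⁻ z', F (((w, x), (p, x')), (z, z')) ∂stdNoise n ∂stdNoise n
        ∂C.enc2 p ∂C.enc1 w := by
  rw [law, lintegral_prod _ hF.aemeasurable, lintegral_prod _ (by fun_prop),
    lintegral_uniformOn_compProd _ (by fun_prop)]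
  congr 1
  refine Finset.sum_congr rfl fun w _ => lintegral_congr fun x => ?_
  rw [lintegral_uniformOn_compProd _ (by fun_prop)]
  congr 1
  refine Finset.sum_congr rfl fun p _ => lintegral_congr fun x' => ?_
  rw [lintegral_prod _ (by fun_prop)]

/-- Integrating user 2 outermost is the order suited to conditioning on `W₂`. -/
lemma lintegral_law_symm {F : ZICOutcome n M1 M2 L → ENNReal} (hF : Measurable F) :
    ∫⁻ ω, F ω ∂C.law = (Fintype.card (Fin M2 × Fin L) : ENNReal)⁻¹ * ∑ p, ∫⁻ x',
      (Fintype.card (Fin M1) : ENNReal)⁻¹ *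
      ∑ w, ∫⁻ x, ∫⁻ z, ∫⁻ z', F (((w, x), (p, x')), (z, z')) ∂stdNoise n ∂stdNoise n
        ∂C.enc1 w ∂C.enc2 p := by
  rw [law, lintegral_prod _ hF.aemeasurable, lintegral_prod_symm _ (by fun_prop),
    lintegral_uniformOn_compProd _ (by fun_prop)]
  congr 1
  refine Finset.sum_congr rfl fun p _ => lintegral_congr fun x' => ?_
  rw [lintegral_uniformOn_compProd _ (by fun_prop)]
  congr 1
  refine Finset.sum_congr rfl fun w _ => lintegral_congr fun x => ?_
  rw [lintegral_prod _ (by fun_prop)]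

lemma map_X1_law : C.law.map ZICOutcome.X1 = avgMeasure fun w => C.enc1 w := by
  refine Measure.ext_of_lintegral _ fun g hg => ?_
  rw [lintegral_map hg (by fun_prop), lintegral_law _ (by fun_prop), lintegral_avgMeasure]
  simp only [ZICOutcome.X1, lintegral_const, measure_univ, mul_one, Finset.sum_const,
    Finset.card_univ, nsmul_eq_mul]
  congr 1
  refine Finset.sum_congr rfl fun w _ => lintegral_congr fun x => ?_
  rw [← mul_assoc, ENNReal.inv_mul_cancel (by simp [NeZero.ne]) (ENNReal.natCast_ne_top _), one_mul]

lemma map_X2_law : C.law.map ZICOutcome.X2 = avgMeasure fun p => C.enc2 p := by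
  refine Measure.ext_of_lintegral _ fun g hg => ?_
  rw [lintegral_map hg (by fun_prop), lintegral_law_symm _ (by fun_prop), lintegral_avgMeasure]
  simp only [ZICOutcome.X2, lintegral_const, measure_univ, mul_one, Finset.sum_const,
    Finset.card_univ, nsmul_eq_mul]
  congr 1
  refine Finset.sum_congr rfl fun p _ => lintegral_congr fun x => ?_
  rw [← mul_assoc, ENNReal.inv_mul_cancel (by simp [NeZero.ne]) (ENNReal.natCast_ne_top _), one_mul]

instance (w : Fin M1) : IsProbabilityMeasure (C.signal1 hd w) :=
  Measure.isProbabilityMeasure_map (by fun_prop)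

instance (w : Fin M2) : IsProbabilityMeasure (C.signal2 hd w) := by
  have (k : Fin L) : IsProbabilityMeasure ((C.enc2 (w, k)).map (hd • · : (Fin n → ℝ) → _)) :=
    Measure.isProbabilityMeasure_map (by fun_prop)
  unfold signal2; infer_instance

variable {hd} {a : ℝ} {ch : GaussianZIC}

lemma map_W1_Y1_law (h1 : ch.h11 = hd) (h2 : ch.h21 = a * hd) :
    C.law.map (fun ω => (ω.W1, ω.Y1 ch)) = avgMeasure fun w => (Measure.dirac w).prod
      ((C.signal1 hd w ∗ (avgMeasure (C.signal2 hd)).map (a • ·)) ∗ stdNoise n) := by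
  have : IsProbabilityMeasure ((avgMeasure (C.signal2 hd)).map (a • ·)) :=
    Measure.isProbabilityMeasure_map (by fun_prop)
  refine Measure.ext_of_lintegral _ fun F hF => ?_
  rw [lintegral_map hF (by fun_prop), lintegral_law _ (by fun_prop),
    lintegral_avgMeasure_dirac_prod _ hF]
  congr 1
  refine Finset.sum_congr rfl fun w _ => ?_
  have hFw : Measurable fun y => F (w, y) := by fun_prop
  rw [Measure.lintegral_conv hFw, Measure.lintegral_conv (by fun_prop), signal1,
    lintegral_map (by fun_prop) (by fun_prop)]
  refine lintegral_congr fun x => ?_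
  rw [lintegral_map (by fun_prop) (by fun_prop), avgMeasure_signal2,
    lintegral_map (by fun_prop) (by fun_prop), lintegral_avgMeasure]
  simp [ZICOutcome.W1, ZICOutcome.Y1_eq, h1, h2, smul_smul]

lemma map_W2_Y1_law (h1 : ch.h11 = hd) (h2 : ch.h21 = a * hd) :
    C.law.map (fun ω => (ω.W2, ω.Y1 ch)) = avgMeasure fun w => (Measure.dirac w).prod
      (((C.signal2 hd w).map (a • ·) ∗ avgMeasure (C.signal1 hd)) ∗ stdNoise n) := by
  have (w : Fin M2) : IsProbabilityMeasure ((C.signal2 hd w).map (a • ·)) :=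
    Measure.isProbabilityMeasure_map (by fun_prop)
  refine Measure.ext_of_lintegral _ fun F hF => ?_
  rw [lintegral_map hF (by fun_prop), lintegral_law_symm _ (by fun_prop),
    lintegral_avgMeasure_dirac_prod _ hF, Fintype.card_prod, Nat.cast_mul,
    ENNReal.mul_inv (by simp) (by simp), Fintype.sum_prod_type, mul_assoc, Finset.mul_sum]
  congr 1
  refine Finset.sum_congr rfl fun w _ => ?_
  have hFw : Measurable fun y => F (w, y) := by fun_prop
  rw [Measure.lintegral_conv hFw, Measure.lintegral_conv (by fun_prop),
    lintegral_map (by fun_prop) (by fun_prop), signal2, lintegral_avgMeasure]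
  congr 1
  refine Finset.sum_congr rfl fun k _ => ?_
  rw [lintegral_map (by fun_prop) (by fun_prop)]
  refine lintegral_congr fun x' => ?_
  rw [lintegral_avgMeasure]
  congr 1
  refine Finset.sum_congr rfl fun w1 _ => ?_
  rw [signal1, lintegral_map (by fun_prop) (by fun_prop)]
  simp [ZICOutcome.W2, ZICOutcome.Y1_eq, h1, h2, smul_smul, add_comm]

lemma map_W2_Y2_law (h1 : ch.h22 = hd) :
    C.law.map (fun ω => (ω.W2, ω.Y2 ch)) = avgMeasure fun w => (Measure.dirac w).prod
      (C.signal2 hd w ∗ stdNoise n) := by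
  refine Measure.ext_of_lintegral _ fun F hF => ?_
  rw [lintegral_map hF (by fun_prop), lintegral_law_symm _ (by fun_prop),
    lintegral_avgMeasure_dirac_prod _ hF, Fintype.card_prod, Nat.cast_mul,
    ENNReal.mul_inv (by simp) (by simp), Fintype.sum_prod_type, mul_assoc, Finset.mul_sum]
  congr 1
  refine Finset.sum_congr rfl fun w _ => ?_
  have hFw : Measurable fun y => F (w, y) := by fun_prop
  rw [Measure.lintegral_conv hFw, signal2, lintegral_avgMeasure]
  congr 1
  refine Finset.sum_congr rfl fun k _ => ?_
  rw [lintegral_map (by fun_prop) (by fun_prop)]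
  refine lintegral_congr fun x' => ?_
  simp only [ZICOutcome.W2, ZICOutcome.Y2_eq, h1, lintegral_const, measure_univ, mul_one,
    Finset.sum_const, Finset.card_univ, nsmul_eq_mul]
  rw [← mul_assoc, ENNReal.inv_mul_cancel (by simp [NeZero.ne]) (ENNReal.natCast_ne_top _), one_mul]

lemma sum_lintegral_coord_sq {Ω : Type*} [MeasurableSpace Ω] (μ : Measure Ω)
    {X : Ω → Fin n → ℝ} (hX : Measurable X) :
    ∑ t, ∫⁻ ω, ENNReal.ofReal (X ω t ^ 2) ∂μ =
      ∫⁻ x, ENNReal.ofReal (sqNorm x) ∂(μ.map X) := by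
  rw [lintegral_map (by fun_prop) hX, ← lintegral_finsetSum _ fun t _ => by fun_prop]
  refine lintegral_congr fun ω => ?_
  rw [sqNorm, ENNReal.ofReal_sum_of_nonneg fun t _ => sq_nonneg _]

lemma hasSecondMoment_signal (C : ZICCode n M1 M2 L) {P : ℝ} (hP : 0 ≤ P)
    (hP1 : ch.P1 = P) (hP2 : ch.P2 = P) (h : C.SatisfiesPower ch) (hd : ℝ) :
    (∀ w, HasSecondMoment (C.signal1 hd w)) ∧ (∀ w, HasSecondMoment (C.signal2 hd w)) ∧
      ∫ x, sqNorm x ∂avgMeasure (C.signal1 hd) ≤ n * (hd ^ 2 * P) ∧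
      ∫ x, sqNorm x ∂avgMeasure (C.signal2 hd) ≤ n * (hd ^ 2 * P) := by
  obtain ⟨h1, h2⟩ := h
  have hnP : 0 ≤ n * P := by positivity
  rw [sum_lintegral_coord_sq _ (by fun_prop), map_X1_law, hP1] at h1
  rw [sum_lintegral_coord_sq _ (by fun_prop), map_X2_law, hP2] at h2
  obtain ⟨m1, b1⟩ := hasSecondMoment_of_lintegral_avgMeasure_le _ hnP h1
  obtain ⟨m2, b2⟩ := hasSecondMoment_of_lintegral_avgMeasure_le _ hnP h2
  refine ⟨fun w => ?_, fun w => ?_, ?_, ?_⟩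
  · rw [signal1]; infer_instance
  · rw [signal2]; infer_instance
  · rw [avgMeasure_signal1, integral_map (by fun_prop) measurable_sqNorm.aestronglyMeasurable]
    simp_rw [sqNorm_smul]
    rw [integral_const_mul]
    nlinarith [sq_nonneg hd]
  · rw [avgMeasure_signal2, integral_map (by fun_prop) measurable_sqNorm.aestronglyMeasurable]
    simp_rw [sqNorm_smul]
    rw [integral_const_mul]
    nlinarith [sq_nonneg hd]

/-! ### The bound at a fixed block length. -/

lemma measure_avgMeasure_dirac_prod {ι : Type*} [Fintype ι] [MeasurableSpace ι]
    (ρ : ι → Measure (Fin n → ℝ)) [∀ i, IsProbabilityMeasure (ρ i)]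
    {s : Set (ι × (Fin n → ℝ))} (hs : MeasurableSet s) :
    (avgMeasure fun i => (Measure.dirac i).prod (ρ i)) s =
      (Fintype.card ι : ENNReal)⁻¹ * ∑ i, ρ i {y | (i, y) ∈ s} := by
  rw [← lintegral_indicator_one hs, lintegral_avgMeasure_dirac_prod _
    (measurable_one.indicator hs)]
  congr 1
  refine Finset.sum_congr rfl fun i _ => ?_
  have hi : MeasurableSet {y | (i, y) ∈ s} := (measurable_prodMk_left (x := i)) hs
  rw [← lintegral_indicator_one hi]
  rfl

lemma le_smoothInfo_receiver1 (h1 : ch.h11 = hd) (h2 : ch.h21 = a * hd)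
    (hm1 : ∀ w, HasSecondMoment (C.signal1 hd w)) (hm2 : ∀ w, HasSecondMoment (C.signal2 hd w)) :
    (1 - (C.errorProb1 ch).toReal) * Real.log M1 - Real.log 2 ≤
      smoothInfo fun w => C.signal1 hd w ∗ (avgMeasure (C.signal2 hd)).map (a • ·) := by
  have hS : ∀ w, MeasurableSet {y | C.dec1 y = w} := fun w =>
    C.dec1_measurable (measurableSet_singleton w)
  have := le_smoothInfo_of_list
    (fun w => C.signal1 hd w ∗ (avgMeasure (C.signal2 hd)).map (a • ·))
    (fun w => {y | C.dec1 y = w}) hS one_pos (fun y => by simp)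
    (p := (C.errorProb1 ch).toReal) ?_
  · simpa using this
  · refine le_of_eq ?_
    have hs : MeasurableSet {p : Fin M1 × (Fin n → ℝ) | C.dec1 p.2 ≠ p.1} :=
      (measurableSet_eq_fun (C.dec1_measurable.comp measurable_snd) measurable_fst).compl
    have he : C.errorProb1 ch = (C.law.map fun ω => (ω.W1, ω.Y1 ch))
        {p | C.dec1 p.2 ≠ p.1} := by
      rw [Measure.map_apply (by fun_prop) hs]
      rfl
    rw [he, C.map_W1_Y1_law h1 h2, measure_avgMeasure_dirac_prod _ hs, ENNReal.toReal_mul,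
      ENNReal.toReal_sum fun i _ => measure_ne_top _ _, ENNReal.toReal_inv,
      ENNReal.toReal_natCast]
    rfl

/-- Ignoring the key, the decodings of `Y₂` under all keys form a list of at most `L` messages,
which contains `W₂` whenever the true decoder succeeds. The key thus costs at most `log L`. -/
lemma le_smoothInfo_receiver2 (h1 : ch.h22 = hd)
    (hm2 : ∀ w, HasSecondMoment (C.signal2 hd w)) :
    (1 - (C.errorProb2 ch).toReal) * Real.log M2 - Real.log L - Real.log 2 ≤
      smoothInfo (C.signal2 hd) := by
  have hdec : ∀ k, Measurable fun y => C.dec2 (y, k) := fun k =>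
    C.dec2_measurable.comp (by fun_prop)
  have hS : ∀ w, MeasurableSet {y | ∃ k, C.dec2 (y, k) = w} := by
    intro w
    rw [Set.ofPred_exists]
    exact MeasurableSet.iUnion fun k => hdec k (measurableSet_singleton w)
  have := le_smoothInfo_of_list (C.signal2 hd)
    (fun w => {y | ∃ k, C.dec2 (y, k) = w}) hS (NeZero.pos L) (fun y => ?_)
    (p := (C.errorProb2 ch).toReal) ?_
  · simpa using this
  · have h2 : {w | y ∈ {y | ∃ k, C.dec2 (y, k) = w}} = (fun k => C.dec2 (y, k)) '' Set.univ := by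
      ext w; simp
    rw [h2]
    refine (Set.ncard_image_le Set.finite_univ).trans ?_
    simp [Set.ncard_univ]
  · have hs : MeasurableSet {p : Fin M2 × (Fin n → ℝ) | ¬ ∃ k, C.dec2 (p.2, k) = p.1} := by
      have h3 : MeasurableSet {p : Fin M2 × (Fin n → ℝ) | ∃ k, C.dec2 (p.2, k) = p.1} := by
        rw [Set.ofPred_exists]
        exact MeasurableSet.iUnion fun k =>
          measurableSet_eq_fun ((hdec k).comp measurable_snd) measurable_fst
      exact h3.compl
    have he : (C.law.map fun ω => (ω.W2, ω.Y2 ch)) {p | ¬ ∃ k, C.dec2 (p.2, k) = p.1} ≤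
        C.errorProb2 ch := by
      rw [Measure.map_apply (by fun_prop) hs, errorProb2]
      refine measure_mono fun ω hω => ?_
      simp only [Set.mem_preimage, Set.mem_ofPred_eq, not_exists] at hω
      exact hω _
    rw [C.map_W2_Y2_law h1, measure_avgMeasure_dirac_prod _ hs] at he
    have := ENNReal.toReal_mono (measure_ne_top _ _) he
    rw [ENNReal.toReal_mul, ENNReal.toReal_sum fun i _ => measure_ne_top _ _,
      ENNReal.toReal_inv, ENNReal.toReal_natCast] at this
    exact this

lemma smoothInfo_le_leakage (h1 : ch.h11 = hd) (h2 : ch.h21 = a * hd)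
    (hm1 : ∀ w, HasSecondMoment (C.signal1 hd w)) (hm2 : ∀ w, HasSecondMoment (C.signal2 hd w))
    (hleak : C.leakage ch ≠ ⊤) :
    smoothInfo (fun w => (C.signal2 hd w).map (a • ·) ∗ avgMeasure (C.signal1 hd)) ≤
      (C.leakage ch).toReal * Real.log 2 := by
  have hlog : 0 < Real.log 2 := Real.log_pos one_lt_two
  set ν := fun w => (C.signal2 hd w).map (a • ·) ∗ avgMeasure (C.signal1 hd) with hν
  have hJ : C.law.map (fun ω => (ω.W2, ω.Y1 ch)) =
      avgMeasure fun w => (Measure.dirac w).prod (ν w ∗ stdNoise n) := C.map_W2_Y1_law h1 h2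
  have hW : C.law.map ZICOutcome.W2 = avgMeasure Measure.dirac := by
    rw [← map_fst_avgMeasure_dirac_prod fun w => ν w ∗ stdNoise n, ← hJ,
      Measure.map_map (by fun_prop) (by fun_prop)]
    rfl
  have hY : C.law.map (ZICOutcome.Y1 ch) = avgMeasure ν ∗ stdNoise n := by
    rw [avgMeasure_conv, ← map_snd_avgMeasure_dirac_prod fun w => ν w ∗ stdNoise n, ← hJ,
      Measure.map_map (by fun_prop) (by fun_prop)]
    rfl
  rw [leakage, mutualInfoBits, hJ, hW, hY] at hleak ⊢
  -- Finiteness is essential, since `toReal` sends `⊤` to 0.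
  have hfin : InformationTheory.klDiv (avgMeasure fun w => (Measure.dirac w).prod
      (ν w ∗ stdNoise n)) ((avgMeasure Measure.dirac).prod (avgMeasure ν ∗ stdNoise n)) ≠ ⊤ := by
    intro htop
    rw [htop, ENNReal.top_div_of_ne_top ENNReal.ofReal_ne_top] at hleak
    exact hleak rfl
  rw [ENNReal.toReal_div, ENNReal.toReal_ofReal hlog.le, div_mul_cancel₀ _ hlog.ne']
  exact smoothInfo_le_klDiv ν hfin

/-- The outer bound for a fixed block length, in nats. -/
theorem sum_log_card_le {P : ℝ} (hP : 0 ≤ P) (ha : a ^ 2 < 1)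
    (hch : ch = GaussianZIC.symmetric hd (a * hd) P) (hpow : C.SatisfiesPower ch)
    (hleak : C.leakage ch ≠ ⊤) :
    (1 - (C.errorProb1 ch).toReal) * Real.log M1 + (1 - (C.errorProb2 ch).toReal) * Real.log M2
        - Real.log L - 2 * Real.log 2 ≤
      (C.leakage ch).toReal * Real.log 2 + n / 2 * (2 * Real.log (1 + hd ^ 2 * P) -
        Real.log (1 + a ^ 2 * (hd ^ 2 * P))) := by
  have h11 : ch.h11 = hd := by rw [hch]; rfl
  have h21 : ch.h21 = a * hd := by rw [hch]; rfl
  have h22 : ch.h22 = hd := by rw [hch]; rfl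
  obtain ⟨hm1, hm2, hA, hB⟩ := C.hasSecondMoment_signal (ch := ch) hP (by rw [hch]; rfl)
    (by rw [hch]; rfl) hpow hd
  have hQ : 0 ≤ hd ^ 2 * P := by positivity
  have f1 := C.le_smoothInfo_receiver1 h11 h21 hm1 hm2
  have f2 := C.le_smoothInfo_receiver2 h22 hm2
  have f3 := C.smoothInfo_le_leakage h11 h21 hm1 hm2 hleak
  set A := avgMeasure (C.signal1 hd) with hAdef
  set B := avgMeasure (C.signal2 hd) with hBdef
  have hc := smoothEntropy_le A hQ hA
  have hdd := smoothEntropy_sub_map_le B ha hQ hB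
  -- Averaging over `W₁` or over `W₂` gives the same noiseless input law at receiver 1, so the
  -- entropy of `Y₁` cancels between `f1` and `f3`.
  have e1 : avgMeasure (fun w => C.signal1 hd w ∗ B.map (a • ·)) = A ∗ B.map (a • ·) :=
    (avgMeasure_conv _ _).symm
  have e2 : avgMeasure (fun w => (C.signal2 hd w).map (a • ·) ∗ A) = A ∗ B.map (a • ·) := by
    rw [← avgMeasure_conv, ← map_avgMeasure _ (by fun_prop), Measure.conv_comm]
  have hM1 : (0 : ℝ) < M1 := by exact_mod_cast NeZero.pos M1
  have hM2 : (0 : ℝ) < M2 := by exact_mod_cast NeZero.pos M2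
  -- Given `W₁`, the interference plus noise is still present in `Y₁` and the remaining randomness
  -- of `X₁` only adds entropy.
  have g1 : smoothEntropy (B.map (a • ·)) ≤
      (M1 : ℝ)⁻¹ * ∑ w, smoothEntropy (C.signal1 hd w ∗ B.map (a • ·)) := by
    rw [inv_mul_eq_div, le_div_iff₀ hM1]
    have := Finset.card_nsmul_le_sum Finset.univ
      (fun w => smoothEntropy (C.signal1 hd w ∗ B.map (a • ·))) (smoothEntropy (B.map (a • ·)))
      fun w _ => smoothEntropy_le_conv _ _
    simp only [Finset.card_univ, Fintype.card_fin, nsmul_eq_mul] at this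
    linarith
  -- Data processing for each message `w`, averaged.
  have g2 : (M2 : ℝ)⁻¹ * ∑ w, smoothEntropy ((C.signal2 hd w).map (a • ·) ∗ A) ≤
      (M2 : ℝ)⁻¹ * ∑ w, smoothEntropy (C.signal2 hd w) +
        (smoothEntropy A - n / 2 * (Real.log (2 * Real.pi) + 1)) := by
    have := Finset.sum_le_sum fun (w : Fin M2) (_ : w ∈ Finset.univ) =>
      smoothEntropy_conv_map_le A (C.signal2 hd w) ha.le
    simp only [Measure.conv_comm A] at this
    simp only [Finset.sum_add_distrib, Finset.sum_const, Finset.card_univ, Fintype.card_fin,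
      nsmul_eq_mul] at this
    rw [inv_mul_eq_div, inv_mul_eq_div, div_add' _ _ _ hM2.ne', div_le_div_iff_of_pos_right hM2]
    linarith
  simp only [smoothInfo, Fintype.card_fin] at f1 f2 f3
  rw [e1] at f1
  rw [e2] at f3
  have hl : Real.log (2 * Real.pi * (1 + hd ^ 2 * P)) =
      Real.log (2 * Real.pi) + Real.log (1 + hd ^ 2 * P) :=
    Real.log_mul (by positivity) (by positivity)
  rw [hl] at hc
  linarith

end ZICCode

/-! ### Rates and the limit of large block length. -/

lemma indexCount_pos (n : ℕ) {R : ℝ} (hR : 0 ≤ R) : 0 < indexCount n R :=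
  Nat.floor_pos.2 (Real.one_le_rpow one_le_two (by positivity))

lemma log_indexCount_le (n : ℕ) {R : ℝ} (hR : 0 ≤ R) :
    Real.log (indexCount n R) ≤ n * R * Real.log 2 := by
  rw [← Real.log_rpow two_pos]
  exact Real.log_le_log (by exact_mod_cast indexCount_pos n hR) (Nat.floor_le (by positivity))

/-- Rounding costs at most one bit: a positive integer `k` satisfies `k + 1 ≤ 2k`. -/
lemma le_log_indexCount (n : ℕ) {R : ℝ} (hR : 0 ≤ R) :
    n * R * Real.log 2 - Real.log 2 ≤ Real.log (indexCount n R) := by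
  have h1 : (1 : ℝ) ≤ indexCount n R := by exact_mod_cast indexCount_pos n hR
  have h2 : (2 : ℝ) ^ ((n : ℝ) * R) < indexCount n R + 1 := Nat.lt_floor_add_one _
  rw [← Real.log_rpow two_pos, sub_le_iff_le_add, ← Real.log_mul (by positivity) two_ne_zero]
  exact Real.log_le_log (by positivity) (by linarith)

theorem theorem3 (hd hc P SNR INR RK R1 R2 : ℝ) (hP : 0 ≤ P) (hRK : 0 ≤ RK)
    (hSNR : SNR = hd ^ 2 * P) (hINR : INR = hc ^ 2 * P) (hlt : INR < SNR)
    (hach : (GaussianZIC.symmetric hd hc P).IsSecrecyAchievable RK R1 R2) :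
    R1 + R2 ≤ Real.logb 2 (1 + SNR) - 0.5 * Real.logb 2 (1 + INR) + RK := by
  obtain ⟨hR1, hR2, C, hpow, he1, he2, ε, hε, hleak⟩ := hach
  have hlog : 0 < Real.log 2 := Real.log_pos one_lt_two
  have hPpos : 0 < P := by
    rcases hP.eq_or_lt with h | h
    · simp [hSNR, hINR, ← h] at hlt
    · exact h
  have hsq : hc ^ 2 < hd ^ 2 := by
    rw [hSNR, hINR] at hlt
    exact lt_of_mul_lt_mul_right hlt hP
  have hd0 : hd ≠ 0 := by
    rintro rfl
    nlinarith [sq_nonneg hc]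
  have hd2 : 0 < hd ^ 2 := by positivity
  set a := hc / hd with ha
  have hahd : a * hd = hc := div_mul_cancel₀ _ hd0
  have ha2 : a ^ 2 < 1 := by rw [ha, div_pow, div_lt_one hd2]; exact hsq
  have haQ : a ^ 2 * (hd ^ 2 * P) = INR := by rw [hINR, ← hahd]; ring
  set ch := GaussianZIC.symmetric hd hc P with hch
  set p1 : ℕ → ℝ := fun n => ((C n).errorProb1 ch).toReal with hp1
  set p2 : ℕ → ℝ := fun n => ((C n).errorProb2 ch).toReal with hp2
  have tp1 : Tendsto p1 atTop (𝓝 0) := by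
    exact (ENNReal.tendsto_toReal ENNReal.zero_ne_top).comp he1
  have tp2 : Tendsto p2 atTop (𝓝 0) := by
    exact (ENNReal.tendsto_toReal ENNReal.zero_ne_top).comp he2
  set T := 2 * Real.log (1 + SNR) - Real.log (1 + INR) with hT
  -- Of the four `log 2`, two come from the Fano bounds and two from rounding `M1` and `M2`.
  have key : ∀ᶠ n : ℕ in atTop,
      (1 - p1 n) * R1 * Real.log 2 + (1 - p2 n) * R2 * Real.log 2 ≤
        RK * Real.log 2 + 4 * Real.log 2 * (n : ℝ)⁻¹ + |ε n| * Real.log 2 + T / 2 := by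
    filter_upwards [eventually_gt_atTop 0] with n hn
    have hn' : (0 : ℝ) < n := by exact_mod_cast hn
    have : NeZero (indexCount n R1) := ⟨(indexCount_pos n hR1).ne'⟩
    have : NeZero (indexCount n R2) := ⟨(indexCount_pos n hR2).ne'⟩
    have : NeZero (indexCount n RK) := ⟨(indexCount_pos n hRK).ne'⟩
    have hb := (C n).sum_log_card_le (ch := ch) hP ha2 (by rw [hch, hahd]) (hpow n)
      ((hleak n).trans_lt ENNReal.ofReal_lt_top).ne
    rw [haQ, ← hSNR, ← hT] at hb
    have hl : ((C n).leakage ch).toReal ≤ n * |ε n| :=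
      ENNReal.toReal_le_of_le_ofReal (by positivity)
        ((hleak n).trans (ENNReal.ofReal_le_ofReal (by gcongr; exact le_abs_self _)))
    have hl2 := mul_le_mul_of_nonneg_right hl hlog.le
    -- `(1 - p) log M` is split: the term `p log M` needs the upper bound on `log M`, the term `log
    -- M` the lower one.
    have u1 := mul_le_mul_of_nonneg_left (log_indexCount_le n hR1)
      (ENNReal.toReal_nonneg : 0 ≤ p1 n)
    have u2 := mul_le_mul_of_nonneg_left (log_indexCount_le n hR2)
      (ENNReal.toReal_nonneg : 0 ≤ p2 n)
    have v1 := le_log_indexCount n hR1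
    have v2 := le_log_indexCount n hR2
    have v3 := log_indexCount_le n hRK
    refine le_of_mul_le_mul_left ?_ hn'
    have hinv : (n : ℝ) * (4 * Real.log 2 * (n : ℝ)⁻¹) = 4 * Real.log 2 := by field_simp
    have hexp : (n : ℝ) * (RK * Real.log 2 + 4 * Real.log 2 * (n : ℝ)⁻¹ + |ε n| * Real.log 2 +
        T / 2) = n * RK * Real.log 2 + 4 * Real.log 2 + n * |ε n| * Real.log 2 + n / 2 * T := by
      rw [mul_add, mul_add, mul_add, hinv]; ring
    rw [hexp]
    change (1 - p1 n) * _ + (1 - p2 n) * _ - _ - _ ≤ _ at hb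
    linarith
  have hlim := le_of_tendsto_of_tendsto
    (((tp1.const_sub 1).mul_const R1 |>.mul_const (Real.log 2)).add
      ((tp2.const_sub 1).mul_const R2 |>.mul_const (Real.log 2)))
    ((((tendsto_inv_atTop_nhds_zero_nat (𝕜 := ℝ)).const_mul (4 * Real.log 2)).const_add
      (RK * Real.log 2) |>.add (hε.abs.mul_const (Real.log 2))).add_const (T / 2)) key
  simp only [sub_zero, one_mul, mul_zero, add_zero, abs_zero, zero_mul] at hlim
  simp only [Real.logb]
  have hfin : Real.log (1 + SNR) / Real.log 2 - 0.5 * (Real.log (1 + INR) / Real.log 2) + RK =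
      (RK * Real.log 2 + T / 2) / Real.log 2 := by
    rw [hT]; field_simp; ring
  rw [hfin, le_div_iff₀ hlog]
  linarith
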